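/- Let $p,q$ be coprime integers with $0<p<q$, let $e\in\mathbb Z$, and let $w=(e-1)q-p$. Let $L=L(1/2,1/2,p/q;e)$ be the Montesinos link that is the numerator closure of the sum, from left to right, of the rational tangles with fractions $1/2$, $1/2$, $p/q$ and of $e$ half-twists, the sign of the half-twists being such that they form the integer tangle $-e$ (so that $L$ is unchanged when the fraction of a tangle is replaced by that fraction $\pm 1$ and $e$ by $e\pm1$). Its involutory quandle $Q_2(L)$ is the involutory quandle with one generator for each arc of a diagram of $L$ and, at each crossing, the relation $x_i\rhd x_j=x_k$, where $x_j$ is the overcrossing arc and $x_i,x_k$ are the two undercrossing arcs. Take as generators $1,2,3$ of $Q_2(L)$ the arcs that leave the first tangle $1/2$ at its lower left end, the first tangle $1/2$ at its lower right end, and the second tangle $1/2$ at its upper right end, respectively. The Cayley graph of $Q_2(L)$ has the elements of $Q_2(L)$ as vertices and an edge from $x$ to $x\rhd i$ for each $x\in Q_2(L)$ and each $i\in\{1,2,3\}$. Let $\mathcal C_i$ be its connected component containing the generator $i$. Then $Q_2(L)$ is finite, and: (a) If $q$ is odd, the components of the Cayley graph are $\mathcal C_1=\mathcal C_3$ and $\mathcal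 C_2\neq\mathcal C_1$, and their numbers of vertices are $|\mathcal C_1|=2q|w|$ and $|\mathcal C_2|=2|w|$. (b) If $q$ is even, the components of the Cayley graph are $\mathcal C_1,\mathcal C_2,\mathcal C_3$, which are pairwise distinct, and their numbers of vertices are $|\mathcal C_1|=|\mathcal C_3|=q|w|$ and $|\mathcal C_2|=2|w|$. In both cases $|Q_2(L)|=2(q+1)|w|$. -/

import Mathlib

/-! ## Involutory quandles given by generators and relations

Mathlib writes the quandle operation as a left action: `y ◃ x` is what is usually written
`x ▷ y` or `x ^ y` for a right action. A quandle is involutory when `y ◃ (y ◃ x) = x`. -/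

/-- Formal quandle expressions in the generators `X`; `op a b` stands for `a ▷ b`. -/
inductive QExpr (X : Type) : Type
  | of (x : X) : QExpr X
  | op (a b : QExpr X) : QExpr X

/-- The congruence on expressions generated by the relations `R` and by the axioms of an
involutory quandle. -/
inductive QExpr.Cong {X : Type} (R : Set (QExpr X × QExpr X)) : QExpr X → QExpr X → Prop
  | rel {a b : QExpr X} (h : (a, b) ∈ R) : QExpr.Cong R a b
  | refl (a : QExpr X) : QExpr.Cong R a a
  | symm {a b : QExpr X} (h : QExpr.Cong R a b) : QExpr.Cong R b a
  | trans {a b c : QExpr X} (h : QExpr.Cong R a b) (k : QExpr.Cong R b c) : QExpr.Cong R a c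
  | op {a a' b b' : QExpr X} (h : QExpr.Cong R a a') (k : QExpr.Cong R b b') :
      QExpr.Cong R (QExpr.op a b) (QExpr.op a' b')
  | idem (a : QExpr X) : QExpr.Cong R (QExpr.op a a) a
  | invol (a b : QExpr X) : QExpr.Cong R (QExpr.op (QExpr.op a b) b) a
  | distrib (a b c : QExpr X) :
      QExpr.Cong R (QExpr.op (QExpr.op a b) c) (QExpr.op (QExpr.op a c) (QExpr.op b c))

/-- The setoid of the congruence generated by `R`. -/
def QExpr.setoid {X : Type} (R : Set (QExpr X × QExpr X)) : Setoid (QExpr X) where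
  r := QExpr.Cong R
  iseqv := ⟨QExpr.Cong.refl, QExpr.Cong.symm, QExpr.Cong.trans⟩

/-- The involutory quandle `⟨X | R⟩`. -/
def PresentedInvQuandle {X : Type} (R : Set (QExpr X × QExpr X)) : Type :=
  Quotient (QExpr.setoid R)

namespace PresentedInvQuandle

/-- The class of a generator. -/
def of {X : Type} (R : Set (QExpr X × QExpr X)) (x : X) : PresentedInvQuandle R :=
  Quotient.mk (QExpr.setoid R) (QExpr.of x)

/-- The operation `x ▷ y`. -/
def op {X : Type} {R : Set (QExpr X × QExpr X)} (x y : PresentedInvQuandle R) :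
    PresentedInvQuandle R :=
  Quotient.map₂ QExpr.op (fun _ _ h _ _ k => QExpr.Cong.op h k) x y

instance {X : Type} (R : Set (QExpr X × QExpr X)) : Quandle (PresentedInvQuandle R) where
  act y x := op x y
  invAct y x := op x y
  self_distrib := by
    rintro ⟨z⟩ ⟨y⟩ ⟨x⟩
    exact Quotient.sound (QExpr.Cong.distrib x y z)
  left_inv := by
    rintro ⟨y⟩ ⟨x⟩
    exact Quotient.sound (QExpr.Cong.invol x y)
  right_inv := by
    rintro ⟨y⟩ ⟨x⟩
    exact Quotient.sound (QExpr.Cong.invol x y)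
  fix := by
    rintro ⟨x⟩
    exact Quotient.sound (QExpr.Cong.idem x)

theorem isInvolutory {X : Type} (R : Set (QExpr X × QExpr X)) :
    Rack.IsInvolutory (PresentedInvQuandle R) := by
  rintro ⟨y⟩ ⟨x⟩
  exact Quotient.sound (QExpr.Cong.invol x y)

end PresentedInvQuandle

/-- The Cayley graph of a quandle with respect to a family of elements: `x` is joined to
`g i ◃ x` for each `i`. Edge labels, loops and repeated edges are not recorded, as they do not
affect the connected components. -/
def quandleCayleyGraph {Q ι : Type} [Quandle Q] (g : ι → Q) : SimpleGraph Q :=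
  SimpleGraph.fromRel (fun x y => ∃ i, Shelf.act (g i) x = y)

/-! ## Link diagrams and their involutory quandles -/

/-- An unoriented link diagram, recorded through marked points on its arcs.
`joins` contains pairs of marked points that lie on one and the same arc (together these pairs
generate the relation of lying on the same arc), and `crossings` contains for each crossing a
triple `(u, o, v)` where `o` lies on the overcrossing arc and `u`, `v` lie on the two
undercrossing arcs, one on each side. -/
structure LinkDiagram where
  Pt : Type
  joins : Set (Pt × Pt)
  crossings : Set (Pt × Pt × Pt)

namespace LinkDiagram

/-- The Wirtinger relations: marked points on one arc are equal, and `u ▷ o = v` at each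
crossing. -/
def relations (D : LinkDiagram) : Set (QExpr D.Pt × QExpr D.Pt) :=
  {r | ∃ a b, (a, b) ∈ D.joins ∧ r = (QExpr.of a, QExpr.of b)} ∪
  {r | ∃ u o v, (u, o, v) ∈ D.crossings ∧ r = (QExpr.op (QExpr.of u) (QExpr.of o), QExpr.of v)}

/-- The involutory quandle `Q₂` of a link diagram. -/
abbrev InvQuandle (D : LinkDiagram) : Type := PresentedInvQuandle D.relations

/-- The element of `Q₂` given by the arc through a marked point. -/
def arc (D : LinkDiagram) (a : D.Pt) : D.InvQuandle := PresentedInvQuandle.of D.relations a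

end LinkDiagram

/-! ## Tangle diagrams -/

/-- The four corners of the square in which a tangle diagram is drawn. -/
inductive Corner : Type
  | nw | ne | sw | se

/-- Diagrams of algebraic tangles. -/
inductive Tangle : Type
  /-- two horizontal strands (fraction `0`) -/
  | zero : Tangle
  /-- two vertical strands (fraction `∞`) -/
  | infty : Tangle
  /-- one crossing, the overstrand joins `sw` to `ne` (fraction `1`) -/
  | pos : Tangle
  /-- one crossing, the overstrand joins `nw` to `se` (fraction `-1`) -/
  | neg : Tangle
  /-- `S` to the left of `T`, the right ends of `S` joined to the left ends of `T` -/
  | hadd (S T : Tangle) : Tangle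
  /-- `S` on top of `T`, the lower ends of `S` joined to the upper ends of `T` -/
  | vadd (S T : Tangle) : Tangle

namespace Tangle

/-- The marked points of a tangle diagram: the four ends of each elementary piece. -/
def Pt : Tangle → Type
  | zero => Corner
  | infty => Corner
  | pos => Corner
  | neg => Corner
  | hadd S T => Pt S ⊕ Pt T
  | vadd S T => Pt S ⊕ Pt T

/-- The four ends of a tangle diagram. -/
def corner : (T : Tangle) → Corner → T.Pt
  | zero, c => c
  | infty, c => c
  | pos, c => c
  | neg, c => c
  | hadd S _, .nw => Sum.inl (corner S .nw)
  | hadd S _, .sw => Sum.inl (corner S .sw)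
  | hadd _ T, .ne => Sum.inr (corner T .ne)
  | hadd _ T, .se => Sum.inr (corner T .se)
  | vadd S _, .nw => Sum.inl (corner S .nw)
  | vadd S _, .ne => Sum.inl (corner S .ne)
  | vadd _ T, .sw => Sum.inr (corner T .sw)
  | vadd _ T, .se => Sum.inr (corner T .se)

/-- Pairs of marked points joined by a strand without undercrossing between them. -/
def joins : (T : Tangle) → Set (T.Pt × T.Pt)
  | zero => {r : Corner × Corner | r = (.nw, .ne) ∨ r = (.sw, .se)}
  | infty => {r : Corner × Corner | r = (.nw, .sw) ∨ r = (.ne, .se)}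
  | pos => {r : Corner × Corner | r = (.sw, .ne)}
  | neg => {r : Corner × Corner | r = (.nw, .se)}
  | hadd S T => {r : (S.Pt ⊕ T.Pt) × (S.Pt ⊕ T.Pt) |
      (∃ a b, (a, b) ∈ joins S ∧ r = (.inl a, .inl b)) ∨
      (∃ a b, (a, b) ∈ joins T ∧ r = (.inr a, .inr b)) ∨
      r = (.inl (S.corner .ne), .inr (T.corner .nw)) ∨
      r = (.inl (S.corner .se), .inr (T.corner .sw))}
  | vadd S T => {r : (S.Pt ⊕ T.Pt) × (S.Pt ⊕ T.Pt) |
      (∃ a b, (a, b) ∈ joins S ∧ r = (.inl a, .inl b)) ∨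
      (∃ a b, (a, b) ∈ joins T ∧ r = (.inr a, .inr b)) ∨
      r = (.inl (S.corner .sw), .inr (T.corner .nw)) ∨
      r = (.inl (S.corner .se), .inr (T.corner .ne))}

/-- The crossings of a tangle diagram, as triples (under, over, under). -/
def crossings : (T : Tangle) → Set (T.Pt × T.Pt × T.Pt)
  | zero => (∅ : Set (Corner × Corner × Corner))
  | infty => (∅ : Set (Corner × Corner × Corner))
  | pos => {r : Corner × Corner × Corner | r = (.nw, .ne, .se)}
  | neg => {r : Corner × Corner × Corner | r = (.ne, .nw, .sw)}
  | hadd S T => {r : (S.Pt ⊕ T.Pt) × (S.Pt ⊕ T.Pt) × (S.Pt ⊕ T.Pt) |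
      (∃ u o v, (u, o, v) ∈ crossings S ∧ r = (.inl u, .inl o, .inl v)) ∨
      (∃ u o v, (u, o, v) ∈ crossings T ∧ r = (.inr u, .inr o, .inr v))}
  | vadd S T => {r : (S.Pt ⊕ T.Pt) × (S.Pt ⊕ T.Pt) × (S.Pt ⊕ T.Pt) |
      (∃ u o v, (u, o, v) ∈ crossings S ∧ r = (.inl u, .inl o, .inl v)) ∨
      (∃ u o v, (u, o, v) ∈ crossings T ∧ r = (.inr u, .inr o, .inr v))}

/-- The numerator closure: the two upper ends are joined to each other, and so are the two
lower ends. -/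
def closure (T : Tangle) : LinkDiagram where
  Pt := T.Pt
  joins := T.joins ∪ {(T.corner .nw, T.corner .ne), (T.corner .sw, T.corner .se)}
  crossings := T.crossings

/-- The standard diagram of the rational tangle with fraction `p / q`, for natural numbers
`p`, `q` that are coprime, along the Euclidean algorithm (that is, along the continued fraction
of `p / q`): adding a crossing on the right takes the fraction `x` to `x + 1`, adding one at the
bottom takes `x` to `1 / (1 + 1 / x)`. -/
def rational (p q : ℕ) : Tangle :=
  if p = 0 then zero
  else if q = 0 then infty
  else if q ≤ p then hadd (rational (p - q) q) pos
  else vadd (rational p (q - p)) pos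
termination_by p + q
decreasing_by all_goals omega

/-- A row of `n` equal half-twists. -/
def row (c : Tangle) : ℕ → Tangle
  | 0 => zero
  | n + 1 => hadd (row c n) c

/-- The integer tangle with fraction `n`. -/
def integer (n : ℤ) : Tangle :=
  if 0 ≤ n then row pos n.natAbs else row neg n.natAbs

/-- The Montesinos link `L(p₁/q₁, p₂/q₂, p₃/q₃; e)`, cut open. The sign of the half-twists is
such that `L` does not change if some `pᵢ` is replaced by `pᵢ ± qᵢ` and `e` by `e ± 1`: they form
the integer tangle `-e`. -/
def montesinos (p₁ q₁ p₂ q₂ p₃ q₃ : ℕ) (e : ℤ) : Tangle :=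
  hadd (rational p₁ q₁) (hadd (rational p₂ q₂) (hadd (rational p₃ q₃) (integer (-e))))

end Tangle

/-- The diagram of the link `L(1/2, 1/2, p/q; e)`. -/
abbrev linkL (p q : ℕ) (e : ℤ) : LinkDiagram := (Tangle.montesinos 1 2 1 2 p q e).closure

namespace linkL

/-- Marked points on the three arcs that are chosen as generators: the arcs `1` and `2` leave the
first tangle `1/2` at its lower left and lower right end, the arc `3` leaves the second
tangle `1/2` at its upper right end. -/
def genPt (p q : ℕ) (e : ℤ) : Fin 3 → (linkL p q e).Pt
  | 0 => Sum.inl ((Tangle.rational 1 2).corner .sw)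
  | 1 => Sum.inl ((Tangle.rational 1 2).corner .se)
  | 2 => Sum.inr (Sum.inl ((Tangle.rational 1 2).corner .ne))

/-- The generators `1`, `2`, `3` of `Q₂(L)`, indexed from `0`. -/
def gen (p q : ℕ) (e : ℤ) (i : Fin 3) : (linkL p q e).InvQuandle :=
  (linkL p q e).arc (genPt p q e i)

/-- The Cayley graph of `Q₂(L)` with respect to the generators `1`, `2`, `3`. -/
def cayleyGraph (p q : ℕ) (e : ℤ) : SimpleGraph (linkL p q e).InvQuandle :=
  quandleCayleyGraph (gen p q e)

/-- The component `C₁` of the Cayley graph. -/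
def C₁ (p q : ℕ) (e : ℤ) : (cayleyGraph p q e).ConnectedComponent :=
  (cayleyGraph p q e).connectedComponentMk (gen p q e 0)

/-- The component `C₂` of the Cayley graph. -/
def C₂ (p q : ℕ) (e : ℤ) : (cayleyGraph p q e).ConnectedComponent :=
  (cayleyGraph p q e).connectedComponentMk (gen p q e 1)

/-- The component `C₃` of the Cayley graph. -/
def C₃ (p q : ℕ) (e : ℤ) : (cayleyGraph p q e).ConnectedComponent :=
  (cayleyGraph p q e).connectedComponentMk (gen p q e 2)

end linkL

/-! Everything is expressed through maps h : ℤ → Q with h j ◃ h i = h (2j - i). In an involutory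
quandle any two elements are the values at 0 and 1 of such a map (`IsDihedralMap.exists_zero_one`).
The arcs of the rational tangle p/q carry a fixed labelling by integers, with 0, p, q, p + q at the
corners, through which all colourings factor (`Tangle.isDihedral_rational`).

Colouring the link therefore means matching four dihedral maps at the corners of four tangles.
Elimination leaves the map h of the tangle p/q and the generator 2, called b; the generators 1 and 3
are h (-w) and h 0, and three relations between h and b survive (`linkL.exists_isPrismPair`).

Upper bound: these relations give h the period 2qw and give h i ◃ b and h i ◃ h 0 ◃ b the period w
in i, and these three families exhaust the quandle (`IsPrismPair.cover`). Lower bound: an explicit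
quandle on ℤ/2qw ⊔ ℤ/2w satisfies the relations, and the induced homomorphism is bijective
(`linkL.exists_isPrismQuandle`).

Components: every element, not only a generator, acts within components
(`IsPrismQuandle.reachable_act`). The second summand is a single component. In the first, h i is
joined to h (i + 2j), and the action of the second summand changes the parity of the index exactly
when q is odd. For even q the number w is odd, which separates the generators 1 and 3. -/

open Quandles

/-! ### Point reflections of the integers and dihedral maps -/

/-- A property of pairs of integers that is stable under point reflections and holds on the unit
square holds everywhere. -/
theorem Int.reflection_induction₂ {P : ℤ → ℤ → Prop} (h00 : P 0 0) (h10 : P 1 0) (h01 : P 0 1)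
    (h11 : P 1 1) (hP : ∀ a b c d, P a b → P c d → P (2 * c - a) (2 * d - b)) (a b : ℤ) :
    P a b := by
  -- Reflecting in (0, 0) and then in (s, t) is the translation by 2 (s, t), so every point can be
  -- moved to its parity class in the unit square.
  have shift : ∀ s t : ℤ, P s t → ∀ a b, P a b → ∀ k : ℤ, P (a + 2 * k * s) (b + 2 * k * t) := by
    intro s t hst a b hab k
    induction k using Int.induction_on with
    | zero => simpa using hab
    | succ k ih =>
      have := hP _ _ _ _ (hP _ _ _ _ ih h00) hst
      ring_nf at this ⊢
      exact this
    | pred k ih =>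
      have := hP _ _ _ _ (hP _ _ _ _ ih hst) h00
      ring_nf at this ⊢
      exact this
  have base : ∀ s t : ℤ, P s t → P (s + 2 * (a / 2)) (t + 2 * (b / 2)) := by
    intro s t h
    simpa using shift 0 1 h01 _ _ (shift 1 0 h10 _ _ h (a / 2)) (b / 2)
  rcases Int.emod_two_eq_zero_or_one a with ha | ha <;>
    rcases Int.emod_two_eq_zero_or_one b with hb | hb
  · convert base 0 0 h00 using 1 <;> omega
  · convert base 0 1 h01 using 1 <;> omega
  · convert base 1 0 h10 using 1 <;> omega
  · convert base 1 1 h11 using 1 <;> omega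

theorem Int.reflection_induction {P : ℤ → Prop} (h0 : P 0) (h1 : P 1)
    (hP : ∀ a b, P a → P b → P (2 * b - a)) (n : ℤ) : P n :=
  Int.reflection_induction₂ (P := fun a _ => P a) h0 h1 h0 h1 (fun a _ b _ => hP a b) n 0

/-- Every integer is a combination a x + b y, and point reflections of the pairs (a, b) induce those
of ℤ. The four initial values are the corner labels of a tangle. -/
theorem Int.reflection_induction_of_isCoprime {P : ℤ → Prop} {x y : ℤ} (hxy : IsCoprime x y)
    (h0 : P 0) (hx : P x) (hy : P y) (hxy' : P (x + y))
    (hP : ∀ a b, P a → P b → P (2 * b - a)) (n : ℤ) : P n := by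
  obtain ⟨a, b, hab⟩ := hxy
  have := Int.reflection_induction₂ (P := fun a b => P (a * x + b * y)) (by simpa) (by simpa)
    (by simpa) (by simpa) (fun a b c d h k => by convert hP _ _ h k using 1; ring) (n * a) (n * b)
  convert this using 1
  linear_combination (-n) * hab

/-- Homomorphisms from the core quandle of `ℤ`. -/
def IsDihedralMap {Q : Type*} [Quandle Q] (F : ℤ → Q) : Prop :=
  ∀ i j, F j ◃ F i = F (2 * j - i)

namespace IsDihedralMap

variable {Q : Type*} [Quandle Q]

theorem comp_affine {F : ℤ → Q} (hF : IsDihedralMap F) (a b : ℤ) :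
    IsDihedralMap (fun i => F (a + b * i)) := fun i j => by
  rw [hF]; congr 1; ring

theorem ext_zero_one {F G : ℤ → Q} (hF : IsDihedralMap F) (hG : IsDihedralMap G)
    (h0 : F 0 = G 0) (h1 : F 1 = G 1) (n : ℤ) : F n = G n :=
  Int.reflection_induction (P := fun n => F n = G n) h0 h1
    (fun a b ha hb => by rw [← hF, ← hG, ha, hb]) n

theorem ext_of_isCoprime {F G : ℤ → Q} (hF : IsDihedralMap F) (hG : IsDihedralMap G) {x y : ℤ}
    (hxy : IsCoprime x y) (h0 : F 0 = G 0) (hx : F x = G x) (hy : F y = G y)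
    (hxy' : F (x + y) = G (x + y)) (n : ℤ) : F n = G n :=
  Int.reflection_induction_of_isCoprime (P := fun n => F n = G n) hxy h0 hx hy hxy'
    (fun a b ha hb => by rw [← hF, ← hG, ha, hb]) n

theorem map {M : Type*} [Quandle M] {F : ℤ → Q} (hF : IsDihedralMap F) {φ : Q → M}
    (hφ : ∀ x y, φ (x ◃ y) = φ x ◃ φ y) : IsDihedralMap (φ ∘ F) := fun i j => by
  simp only [Function.comp_apply, ← hφ, hF i j]

/-- In an involutory quandle any two elements are consecutive values of a dihedral map. -/
theorem exists_zero_one (hQ : Rack.IsInvolutory Q) (a b : Q) :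
    ∃ F : ℤ → Q, IsDihedralMap F ∧ F 0 = a ∧ F 1 = b := by
  have sq : ∀ x : Q, Rack.act' x * Rack.act' x = 1 := fun x => by
    ext y; exact hQ x y
  have inv : ∀ x : Q, (Rack.act' x)⁻¹ = Rack.act' x := fun x => inv_eq_of_mul_eq_one_left (sq x)
  set s : Equiv.Perm Q := Rack.act' a with hs
  set t : Equiv.Perm Q := Rack.act' b with ht
  set r : Equiv.Perm Q := t * s with hr
  have hsr : s * r * s⁻¹ = r⁻¹ := by
    rw [hr, mul_inv_rev, inv, inv, mul_assoc, mul_assoc t, ← hs, ← ht, hs, sq, mul_one]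
  have hsrk : ∀ k : ℤ, s * r ^ k = r ^ (-k) * s := fun k => by
    have := conj_zpow (i := k) (a := s) (b := r)
    rw [hsr] at this
    rw [zpow_neg, ← inv_zpow, this]; group
  have htr : t = r * s := by rw [hr, mul_assoc, hs, sq, mul_one]
  have hsa : s a = a := Quandle.fix
  have htb : t b = b := Quandle.fix
  have hsb : s b = r⁻¹ b := by
    rw [Equiv.Perm.eq_inv_iff_eq, hr, Equiv.Perm.mul_apply]
    have : s (s b) = b := hQ a b
    rw [this, htb]
  have actmap : ∀ (k : ℤ) (x : Q), Rack.act' ((r ^ k) x) = r ^ k * Rack.act' x * (r ^ k)⁻¹ := by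
    have hom : ∀ (k : ℤ) (x y : Q), (r ^ k) (x ◃ y) = (r ^ k) x ◃ (r ^ k) y := by
      have h1 : ∀ x y : Q, r (x ◃ y) = r x ◃ r y := fun x y => by
        change b ◃ a ◃ x ◃ y = (b ◃ a ◃ x) ◃ (b ◃ a ◃ y)
        exact (congrArg (b ◃ ·) Shelf.self_distrib).trans Shelf.self_distrib
      intro k
      induction k using Int.induction_on with
      | zero => intro x y; simp
      | succ k ih => intro x y; rw [zpow_add_one, Equiv.Perm.mul_apply, h1, ih]; rfl
      | pred k ih =>
        intro x y
        have h2 : r⁻¹ (x ◃ y) = r⁻¹ x ◃ r⁻¹ y := by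
          rw [Equiv.Perm.inv_eq_iff_eq, h1]; simp
        rw [zpow_sub_one, Equiv.Perm.mul_apply, h2, ih]; rfl
    intro k x
    rw [eq_mul_inv_iff_mul_eq]
    ext y
    exact (hom k x y).symm
  let F : ℤ → Q := fun n => (r ^ (n / 2)) (if n % 2 = 0 then a else b)
  have even : ∀ k : ℤ, F (2 * k) = (r ^ k) a := fun k => by
    have h1 : (2 * k) / 2 = k := by omega
    have h2 : (2 * k) % 2 = 0 := by omega
    simp only [F, h1, h2, if_true]
  have odd : ∀ k : ℤ, F (2 * k + 1) = (r ^ k) b := fun k => by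
    have h1 : (2 * k + 1) / 2 = k := by omega
    have h2 : (2 * k + 1) % 2 = 1 := by omega
    simp only [F, h1, h2, one_ne_zero, if_false]
  -- Since s inverts r, conjugating s or t = r s by `r ^ k` shows that F n acts as the n-th
  -- reflection of a dihedral group.
  have actF : ∀ n, Rack.act' (F n) = r ^ n * s := fun n => by
    rcases Int.even_or_odd' n with ⟨k, rfl | rfl⟩
    · rw [even, actmap, mul_assoc, ← zpow_neg, ← hs, hsrk, ← mul_assoc, ← zpow_add]
      congr 2; ring
    · rw [odd, actmap, ← ht, htr, mul_assoc, mul_assoc, ← zpow_neg, hsrk, ← mul_assoc,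
        ← mul_assoc, ← zpow_add_one, ← zpow_add]
      congr 2; ring
  refine ⟨F, fun i j => ?_, by simpa using even 0, by simpa using odd 0⟩
  change Rack.act' (F j) (F i) = _
  rw [actF]
  rcases Int.even_or_odd' i with ⟨k, rfl | rfl⟩
  · rw [even, ← Equiv.Perm.mul_apply, mul_assoc, hsrk, ← mul_assoc, ← zpow_add,
      Equiv.Perm.mul_apply, hsa, ← even]
    congr 1; ring
  · rw [odd, ← Equiv.Perm.mul_apply, mul_assoc, hsrk, ← mul_assoc, ← zpow_add,
      Equiv.Perm.mul_apply, hsb, ← Equiv.Perm.mul_apply, ← zpow_sub_one, ← odd]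
    congr 1; ring

end IsDihedralMap

/-! ### Colourings of rational and integer tangles -/

namespace Tangle

/-- Colourings of a tangle diagram by a quandle. -/
structure IsColouring {Q : Type*} [Quandle Q] (T : Tangle) (col : T.Pt → Q) : Prop where
  joins : ∀ a b, (a, b) ∈ T.joins → col a = col b
  crossings : ∀ u o v, (u, o, v) ∈ T.crossings → col o ◃ col u = col v

/-- A tangle diagram whose colourings by involutory quandles all factor through one labelling by
integers, with labels `0`, `x`, `y`, `x + y` at the corners. -/
structure IsDihedral (T : Tangle) (x y : ℤ) (lab : T.Pt → ℤ) : Prop where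
  nw : lab (T.corner .nw) = 0
  ne : lab (T.corner .ne) = x
  sw : lab (T.corner .sw) = y
  se : lab (T.corner .se) = x + y
  colouring : ∀ {Q : Type} [Quandle Q] {F : ℤ → Q}, Rack.IsInvolutory Q → IsDihedralMap F →
    T.IsColouring (F ∘ lab)
  factor : ∀ {Q : Type} [Quandle Q] {col : T.Pt → Q}, Rack.IsInvolutory Q → T.IsColouring col →
    ∃ F : ℤ → Q, IsDihedralMap F ∧ ∀ a, col a = F (lab a)

theorem isColouring_hadd {Q : Type*} [Quandle Q] {S T : Tangle} {col : (hadd S T).Pt → Q} :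
    (hadd S T).IsColouring col ↔ S.IsColouring (fun a => col (.inl a)) ∧
      T.IsColouring (fun a => col (.inr a)) ∧
      col (.inl (S.corner .ne)) = col (.inr (T.corner .nw)) ∧
      col (.inl (S.corner .se)) = col (.inr (T.corner .sw)) := by
  constructor
  · rintro ⟨h, k⟩
    refine ⟨⟨fun a b hab => h _ _ (.inl ⟨a, b, hab, rfl⟩),
      fun a b c hab => k _ _ _ (.inl ⟨a, b, c, hab, rfl⟩)⟩,
      ⟨fun a b hab => h _ _ (.inr (.inl ⟨a, b, hab, rfl⟩)),
      fun a b c hab => k _ _ _ (.inr ⟨a, b, c, hab, rfl⟩)⟩,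
      h _ _ (.inr (.inr (.inl rfl))), h _ _ (.inr (.inr (.inr rfl)))⟩
  · rintro ⟨h, k, h1, h2⟩
    constructor
    · rintro a b (⟨a', b', hab, e⟩ | ⟨a', b', hab, e⟩ | e | e) <;> cases e
      · exact h.joins _ _ hab
      · exact k.joins _ _ hab
      · exact h1
      · exact h2
    · rintro a b c (⟨a', b', c', hab, e⟩ | ⟨a', b', c', hab, e⟩) <;> cases e
      · exact h.crossings _ _ _ hab
      · exact k.crossings _ _ _ hab

theorem isColouring_vadd {Q : Type*} [Quandle Q] {S T : Tangle} {col : (vadd S T).Pt → Q} :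
    (vadd S T).IsColouring col ↔ S.IsColouring (fun a => col (.inl a)) ∧
      T.IsColouring (fun a => col (.inr a)) ∧
      col (.inl (S.corner .sw)) = col (.inr (T.corner .nw)) ∧
      col (.inl (S.corner .se)) = col (.inr (T.corner .ne)) := by
  constructor
  · rintro ⟨h, k⟩
    refine ⟨⟨fun a b hab => h _ _ (.inl ⟨a, b, hab, rfl⟩),
      fun a b c hab => k _ _ _ (.inl ⟨a, b, c, hab, rfl⟩)⟩,
      ⟨fun a b hab => h _ _ (.inr (.inl ⟨a, b, hab, rfl⟩)),
      fun a b c hab => k _ _ _ (.inr ⟨a, b, c, hab, rfl⟩)⟩,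
      h _ _ (.inr (.inr (.inl rfl))), h _ _ (.inr (.inr (.inr rfl)))⟩
  · rintro ⟨h, k, h1, h2⟩
    constructor
    · rintro a b (⟨a', b', hab, e⟩ | ⟨a', b', hab, e⟩ | e | e) <;> cases e
      · exact h.joins _ _ hab
      · exact k.joins _ _ hab
      · exact h1
      · exact h2
    · rintro a b c (⟨a', b', c', hab, e⟩ | ⟨a', b', c', hab, e⟩) <;> cases e
      · exact h.crossings _ _ _ hab
      · exact k.crossings _ _ _ hab

theorem isColouring_zero {Q : Type*} [Quandle Q] {col : Corner → Q} :
    zero.IsColouring col ↔ col .nw = col .ne ∧ col .sw = col .se := by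
  constructor
  · rintro ⟨h, -⟩
    exact ⟨h .nw .ne (.inl rfl), h .sw .se (.inr rfl)⟩
  · rintro ⟨h, k⟩
    refine ⟨?_, fun _ _ _ h => h.elim⟩
    rintro a b (e | e) <;> cases e
    exacts [h, k]

theorem isColouring_infty {Q : Type*} [Quandle Q] {col : Corner → Q} :
    infty.IsColouring col ↔ col .nw = col .sw ∧ col .ne = col .se := by
  constructor
  · rintro ⟨h, -⟩
    exact ⟨h .nw .sw (.inl rfl), h .ne .se (.inr rfl)⟩
  · rintro ⟨h, k⟩
    refine ⟨?_, fun _ _ _ h => h.elim⟩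
    rintro a b (e | e) <;> cases e
    exacts [h, k]

theorem isColouring_pos {Q : Type*} [Quandle Q] {col : Corner → Q} :
    pos.IsColouring col ↔ col .sw = col .ne ∧ col .ne ◃ col .nw = col .se := by
  constructor
  · rintro ⟨h, k⟩
    exact ⟨h .sw .ne rfl, k .nw .ne .se rfl⟩
  · rintro ⟨h, k⟩
    constructor
    · rintro a b e; cases e; exact h
    · rintro a b c e; cases e; exact k

theorem isColouring_neg {Q : Type*} [Quandle Q] {col : Corner → Q} :
    neg.IsColouring col ↔ col .nw = col .se ∧ col .nw ◃ col .ne = col .sw := by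
  constructor
  · rintro ⟨h, k⟩
    exact ⟨h .nw .se rfl, k .ne .nw .sw rfl⟩
  · rintro ⟨h, k⟩
    constructor
    · rintro a b e; cases e; exact h
    · rintro a b c e; cases e; exact k

theorem isDihedral_zero : ∃ lab, zero.IsDihedral 0 1 lab := by
  refine ⟨fun | Corner.nw => 0 | Corner.ne => 0 | Corner.sw => 1 | Corner.se => 1,
    rfl, rfl, rfl, rfl, fun _ _ => isColouring_zero.2 ⟨rfl, rfl⟩, fun {Q _ col} hQ h => ?_⟩
  obtain ⟨h1, h2⟩ := isColouring_zero.1 h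
  obtain ⟨F, hF, h3, h4⟩ := IsDihedralMap.exists_zero_one hQ (col Corner.nw) (col Corner.sw)
  refine ⟨F, hF, ?_⟩
  rintro (_ | _ | _ | _)
  exacts [h3.symm, h1.symm.trans h3.symm, h4.symm, h2.symm.trans h4.symm]

theorem isDihedral_infty : ∃ lab, infty.IsDihedral 1 0 lab := by
  refine ⟨fun | Corner.nw => 0 | Corner.ne => 1 | Corner.sw => 0 | Corner.se => 1,
    rfl, rfl, rfl, rfl, fun _ _ => isColouring_infty.2 ⟨rfl, rfl⟩, fun {Q _ col} hQ h => ?_⟩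
  obtain ⟨h1, h2⟩ := isColouring_infty.1 h
  obtain ⟨F, hF, h3, h4⟩ := IsDihedralMap.exists_zero_one hQ (col Corner.nw) (col Corner.ne)
  refine ⟨F, hF, ?_⟩
  rintro (_ | _ | _ | _)
  exacts [h3.symm, h4.symm, h1.symm.trans h3.symm, h2.symm.trans h4.symm]

/-- The new overstrand has label x + y and the incoming understrand x, so the crossing relation
forces 2 (x + y) - x at the last corner: no freedom and no constraint is added. -/
theorem IsDihedral.hadd_pos {T : Tangle} {x y : ℤ} {lab : T.Pt → ℤ} (h : T.IsDihedral x y lab) :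
    ∃ lab', (hadd T pos).IsDihedral (x + y) y lab' := by
  let l : Corner → ℤ := fun
    | Corner.nw => x | Corner.ne => x + y | Corner.sw => x + y | Corner.se => x + y + y
  refine ⟨Sum.elim lab l, h.nw, rfl, h.sw, rfl, fun {Q _ F} hQ hF => ?_, fun {Q _ col} hQ hc => ?_⟩
  · refine isColouring_hadd.2 ⟨h.colouring hQ hF, isColouring_pos.2 ⟨rfl, ?_⟩,
      congrArg F h.ne, congrArg F h.se⟩
    change F (x + y) ◃ F x = F (x + y + y)
    rw [hF]; congr 1; ring
  · obtain ⟨h1, h2, h3, h4⟩ := isColouring_hadd.1 hc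
    obtain ⟨h5, h6⟩ := isColouring_pos.1 h2
    obtain ⟨F, hF, h7⟩ := h.factor hQ h1
    have e1 : col (.inr Corner.nw) = F x := by rw [← h.ne, ← h7]; exact h3.symm
    have e2 : col (.inr Corner.sw) = F (x + y) := by rw [← h.se, ← h7]; exact h4.symm
    have e3 : col (.inr Corner.ne) = F (x + y) := h5.symm.trans e2
    refine ⟨F, hF, ?_⟩
    rintro (a | (_ | _ | _ | _))
    · exact h7 a
    · exact e1
    · exact e3
    · exact e2
    · rw [← h6, e3, e1, hF]
      exact congrArg F (show 2 * (x + y) - x = x + y + y by ring)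

theorem IsDihedral.hadd_neg {T : Tangle} {x y : ℤ} {lab : T.Pt → ℤ} (h : T.IsDihedral x y lab) :
    ∃ lab', (hadd T neg).IsDihedral (x - y) y lab' := by
  let l : Corner → ℤ := fun
    | Corner.nw => x | Corner.ne => x - y | Corner.sw => x + y | Corner.se => x - y + y
  refine ⟨Sum.elim lab l, h.nw, rfl, h.sw, rfl, fun {Q _ F} hQ hF => ?_, fun {Q _ col} hQ hc => ?_⟩
  · refine isColouring_hadd.2 ⟨h.colouring hQ hF, isColouring_neg.2 ⟨?_, ?_⟩,
      congrArg F h.ne, congrArg F h.se⟩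
    · change F x = F (x - y + y)
      congr 1; ring
    change F x ◃ F (x - y) = F (x + y)
    rw [hF]; congr 1; ring
  · obtain ⟨h1, h2, h3, h4⟩ := isColouring_hadd.1 hc
    obtain ⟨h5, h6⟩ := isColouring_neg.1 h2
    obtain ⟨F, hF, h7⟩ := h.factor hQ h1
    have e1 : col (.inr Corner.nw) = F x := by rw [← h.ne, ← h7]; exact h3.symm
    have e2 : col (.inr Corner.sw) = F (x + y) := by rw [← h.se, ← h7]; exact h4.symm
    refine ⟨F, hF, ?_⟩
    rintro (a | (_ | _ | _ | _))
    · exact h7 a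
    · exact e1
    -- Here the unknown end is the one acted upon; involutivity solves the crossing relation for it.
    · have h8 : col (.inr Corner.nw) ◃ col (.inr Corner.nw) ◃ col (.inr Corner.ne) =
        col (.inr Corner.ne) := hQ _ _
      rw [← h8, h6, e1, e2, hF]
      exact congrArg F (show 2 * x - (x + y) = x - y by ring)
    · exact e2
    · refine h5.symm.trans (e1.trans ?_)
      exact congrArg F (show x = x - y + y by ring)

theorem IsDihedral.vadd_pos {T : Tangle} {x y : ℤ} {lab : T.Pt → ℤ} (h : T.IsDihedral x y lab) :
    ∃ lab', (vadd T pos).IsDihedral x (x + y) lab' := by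
  let l : Corner → ℤ := fun
    | Corner.nw => y | Corner.ne => x + y | Corner.sw => x + y | Corner.se => x + (x + y)
  refine ⟨Sum.elim lab l, h.nw, h.ne, rfl, rfl, fun {Q _ F} hQ hF => ?_, fun {Q _ col} hQ hc => ?_⟩
  · refine isColouring_vadd.2 ⟨h.colouring hQ hF, isColouring_pos.2 ⟨rfl, ?_⟩,
      congrArg F h.sw, congrArg F h.se⟩
    change F (x + y) ◃ F y = F (x + (x + y))
    rw [hF]; congr 1; ring
  · obtain ⟨h1, h2, h3, h4⟩ := isColouring_vadd.1 hc
    obtain ⟨h5, h6⟩ := isColouring_pos.1 h2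
    obtain ⟨F, hF, h7⟩ := h.factor hQ h1
    have e1 : col (.inr Corner.nw) = F y := by rw [← h.sw, ← h7]; exact h3.symm
    have e2 : col (.inr Corner.ne) = F (x + y) := by rw [← h.se, ← h7]; exact h4.symm
    refine ⟨F, hF, ?_⟩
    rintro (a | (_ | _ | _ | _))
    · exact h7 a
    · exact e1
    · exact e2
    · exact h5.trans e2
    · rw [← h6, e2, e1, hF]
      exact congrArg F (show 2 * (x + y) - y = x + (x + y) by ring)

/-- The corner labels follow the Euclidean algorithm that builds the diagram, starting from the
pairs (0, 1) and (1, 0). -/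
theorem isDihedral_rational (p q : ℕ) (h : Nat.Coprime p q) :
    ∃ lab, (rational p q).IsDihedral p q lab := by
  induction hn : p + q using Nat.strong_induction_on generalizing p q with
  | _ n ih =>
    by_cases hp : p = 0
    · obtain rfl : q = 1 := by subst hp; simpa using h
      rw [rational, if_pos hp, hp]
      exact isDihedral_zero
    by_cases hq : q = 0
    · obtain rfl : p = 1 := by subst hq; simpa using h
      rw [rational, if_neg hp, if_pos hq, hq]
      exact isDihedral_infty
    by_cases hqp : q ≤ p
    · obtain ⟨lab, hl⟩ := ih (p - q + q) (by omega) (p - q) q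
        ((Nat.coprime_sub_self_left hqp).2 h) rfl
      rw [rational, if_neg hp, if_neg hq, if_pos hqp,
        show (p : ℤ) = ((p - q : ℕ) : ℤ) + q by omega]
      exact hl.hadd_pos
    · obtain ⟨lab, hl⟩ := ih (p + (q - p)) (by omega) p (q - p)
        ((Nat.coprime_sub_self_right (by omega)).2 h) rfl
      rw [rational, if_neg hp, if_neg hq, if_neg hqp,
        show (q : ℤ) = p + ((q - p : ℕ) : ℤ) by omega]
      exact hl.vadd_pos

theorem isDihedral_row_pos (n : ℕ) : ∃ lab, (row pos n).IsDihedral n 1 lab := by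
  induction n with
  | zero => exact isDihedral_zero
  | succ n ih =>
    obtain ⟨lab, hl⟩ := ih
    exact_mod_cast hl.hadd_pos

theorem isDihedral_row_neg (n : ℕ) : ∃ lab, (row neg n).IsDihedral (-n) 1 lab := by
  induction n with
  | zero => exact isDihedral_zero
  | succ n ih =>
    obtain ⟨lab, hl⟩ := ih
    rw [show -((n + 1 : ℕ) : ℤ) = -n - 1 by push_cast; ring]
    exact hl.hadd_neg

theorem isDihedral_integer (n : ℤ) : ∃ lab, (integer n).IsDihedral n 1 lab := by
  by_cases h : 0 ≤ n
  · have := isDihedral_row_pos n.natAbs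
    rw [show (n.natAbs : ℤ) = n by omega] at this
    rwa [integer, if_pos h]
  · have := isDihedral_row_neg n.natAbs
    rw [show -(n.natAbs : ℤ) = n by omega] at this
    rwa [integer, if_neg h]

end Tangle

/-! ### Universal property of the involutory quandle of a closed tangle -/

/-- The value of a quandle expression. -/
def QExpr.eval {X M : Type} [Quandle M] (col : X → M) : QExpr X → M
  | .of x => col x
  | .op a b => eval col b ◃ eval col a

namespace PresentedInvQuandle

variable {X : Type} {R : Set (QExpr X × QExpr X)}

theorem induction {P : PresentedInvQuandle R → Prop} (hof : ∀ x, P (of R x))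
    (hact : ∀ x y, P x → P y → P (y ◃ x)) (z : PresentedInvQuandle R) : P z := by
  obtain ⟨z⟩ := z
  induction z with
  | of x => exact hof x
  | op a b iha ihb => exact hact _ _ iha ihb

theorem exists_lift {M : Type} [Quandle M] (hM : Rack.IsInvolutory M) (col : X → M)
    (hcol : ∀ a b, (a, b) ∈ R → a.eval col = b.eval col) :
    ∃ φ : PresentedInvQuandle R → M,
      (∀ x y, φ (x ◃ y) = φ x ◃ φ y) ∧ ∀ x, φ (of R x) = col x := by
  have key : ∀ a b, QExpr.Cong R a b → a.eval col = b.eval col := by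
    intro a b h
    induction h with
    | rel h => exact hcol _ _ h
    | refl => rfl
    | symm _ ih => exact ih.symm
    | trans _ _ ih1 ih2 => exact ih1.trans ih2
    | op _ _ ih1 ih2 => simp only [QExpr.eval, ih1, ih2]
    | idem a => exact Quandle.fix
    | invol a b => exact hM _ _
    | distrib a b c => exact Shelf.self_distrib
  refine ⟨Quotient.lift (QExpr.eval col) key, ?_, fun _ => rfl⟩
  rintro ⟨x⟩ ⟨y⟩
  rfl

end PresentedInvQuandle

namespace Tangle

theorem isColouring_arc (T : Tangle) :
    T.IsColouring (fun a => T.closure.arc a) ∧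
      T.closure.arc (T.corner .nw) = T.closure.arc (T.corner .ne) ∧
      T.closure.arc (T.corner .sw) = T.closure.arc (T.corner .se) := by
  have hj : ∀ a b, (a, b) ∈ T.closure.joins → T.closure.arc a = T.closure.arc b :=
    fun a b h => Quotient.sound (QExpr.Cong.rel (.inl ⟨a, b, h, rfl⟩))
  refine ⟨⟨fun a b h => hj a b (.inl h), fun u o v h => ?_⟩,
    hj _ _ (.inr (.inl rfl)), hj _ _ (.inr (.inr rfl))⟩
  exact Quotient.sound (QExpr.Cong.rel (.inr ⟨u, o, v, h, rfl⟩))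

theorem exists_lift_closure {T : Tangle} {M : Type} [Quandle M] (hM : Rack.IsInvolutory M)
    {col : T.Pt → M} (hcol : T.IsColouring col) (hu : col (T.corner .nw) = col (T.corner .ne))
    (hl : col (T.corner .sw) = col (T.corner .se)) :
    ∃ φ : T.closure.InvQuandle → M,
      (∀ x y, φ (x ◃ y) = φ x ◃ φ y) ∧ ∀ a, φ (T.closure.arc a) = col a := by
  refine PresentedInvQuandle.exists_lift hM col ?_
  rintro a b (⟨a', b', h | h | h, e⟩ | ⟨u, o, v, h, e⟩) <;> cases e
  · exact hcol.joins _ _ h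
  · cases h; exact hu
  · cases h; exact hl
  · exact hcol.crossings _ _ _ h

end Tangle

/-! ### Presentation by a dihedral map and one further generator -/

/-- The relations of `Q₂(L(1/2, 1/2, p/q; e))`, for `w = (e - 1) q - p`, in terms of a dihedral
map `h` and one more generator `b`. -/
structure IsPrismPair {Q : Type*} [Quandle Q] (q w : ℤ) (h : ℤ → Q) (b : Q) : Prop where
  dihedral : IsDihedralMap h
  act_zero : b ◃ h 0 = h q
  act_neg : b ◃ h (-w) = h (q - w)
  comm : h 0 ◃ b = h (-w) ◃ b

/-- The last two clauses say that h and b generate and that the prism relations are defining. Here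
f, g, h, k denote the dihedral maps of the four tangles from left to right; both tangles 1/2 have
corner labels 0, 1, 2, 3. -/
theorem linkL.exists_isPrismPair (p q : ℕ) (e w : ℤ) (hcop : Nat.Coprime p q)
    (hw : w = (e - 1) * (q : ℤ) - (p : ℤ)) :
    ∃ h : ℤ → (linkL p q e).InvQuandle, IsPrismPair q w h (gen p q e 1) ∧
      gen p q e 0 = h (-w) ∧ gen p q e 2 = h 0 ∧
      (∀ P : (linkL p q e).InvQuandle → Prop, (∀ x y, P x → P y → P (y ◃ x)) →
        P (gen p q e 1) → (∀ i, P (h i)) → ∀ x, P x) ∧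
      ∀ (M : Type) [Quandle M] (h' : ℤ → M) (b' : M), Rack.IsInvolutory M →
        IsPrismPair q w h' b' →
        ∃ φ : (linkL p q e).InvQuandle → M, (∀ x y, φ (x ◃ y) = φ x ◃ φ y) ∧
          φ (gen p q e 1) = b' ∧ ∀ i, φ (h i) = h' i := by
  obtain ⟨l₁, t₁⟩ := Tangle.isDihedral_rational 1 2 (by norm_num)
  obtain ⟨l₃, t₃⟩ := Tangle.isDihedral_rational p q hcop
  obtain ⟨l₄, t₄⟩ := Tangle.isDihedral_integer (-e)
  have hQ : Rack.IsInvolutory (linkL p q e).InvQuandle := PresentedInvQuandle.isInvolutory _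
  obtain ⟨hcol, hup, hlow⟩ := Tangle.isColouring_arc (Tangle.montesinos 1 2 1 2 p q e)
  obtain ⟨c₁, hcol, u₁, d₁⟩ := Tangle.isColouring_hadd.1 hcol
  obtain ⟨c₂, hcol, u₂, d₂⟩ := Tangle.isColouring_hadd.1 hcol
  obtain ⟨c₃, c₄, u₃, d₃⟩ := Tangle.isColouring_hadd.1 hcol
  obtain ⟨f, hf, cf⟩ := t₁.factor hQ c₁
  obtain ⟨g, hg, cg⟩ := t₁.factor hQ c₂
  obtain ⟨h, hh, ch⟩ := t₃.factor hQ c₃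
  obtain ⟨k, hk, ck⟩ := t₄.factor hQ c₄
  replace u₁ : f 1 = g 0 := by
    have := (cf _).symm.trans (u₁.trans (cg _)); rwa [t₁.ne, t₁.nw] at this
  replace d₁ : f 3 = g 2 := by
    have := (cf _).symm.trans (d₁.trans (cg _)); rwa [t₁.se, t₁.sw] at this
  replace u₂ : g 1 = h 0 := by
    have := (cg _).symm.trans (u₂.trans (ch _)); rwa [t₁.ne, t₃.nw] at this
  replace d₂ : g 3 = h q := by
    have := (cg _).symm.trans (d₂.trans (ch _)); rwa [t₁.se, t₃.sw] at this
  replace u₃ : h p = k 0 := by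
    have := (ch _).symm.trans (u₃.trans (ck _)); rwa [t₃.ne, t₄.nw] at this
  replace d₃ : h (p + q) = k 1 := by
    have := (ch _).symm.trans (d₃.trans (ck _)); rwa [t₃.se, t₄.sw] at this
  replace hup : f 0 = k (-e) := by
    have := (cf _).symm.trans (hup.trans (ck _)); rwa [t₁.nw, t₄.ne] at this
  replace hlow : f 2 = k (-e + 1) := by
    have := (cf _).symm.trans (hlow.trans (ck _)); rwa [t₁.sw, t₄.se] at this
  have g0 : gen p q e 0 = f 2 := (cf _).trans (congrArg f t₁.sw)
  have g1 : gen p q e 1 = f 3 := (cf _).trans (congrArg f t₁.se)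
  have g2 : gen p q e 2 = g 1 := (cg _).trans (congrArg g t₁.ne)
  -- The twists share two corners with the tangle p/q, so their map is an affine reparametrization
  -- of h.
  have hkh : ∀ i, k i = h (p + q * i) :=
    hk.ext_zero_one (hh.comp_affine p q) (by simp [u₃]) (by simp [d₃])
  -- The number w arises here: the lower right end of the twists is k (1 - e) = h (p + q (1 - e)).
  have f2 : f 2 = h (-w) := by rw [hlow, hkh, hw]; congr 1; ring
  have f0 : f 0 = h (-w - q) := by rw [hup, hkh, hw]; congr 1; ring
  have act : ∀ {F : ℤ → (linkL p q e).InvQuandle}, IsDihedralMap F → ∀ i j m, 2 * j - i = m →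
      F j ◃ F i = F m := fun hF i j m e => e ▸ hF i j
  refine ⟨h, ⟨hh, ?_, ?_, ?_⟩, g0.trans f2, g2.trans u₂, ?_, ?_⟩
  · rw [g1, d₁, ← u₂, ← d₂]
    exact act hg _ _ _ (by norm_num)
  · rw [g1, ← f2, act hf 2 3 4 (by norm_num), ← act hf 0 2 4 (by norm_num), f2, f0]
    exact act hh _ _ _ (by ring)
  · rw [g1, ← f2, act hf 3 2 1 (by norm_num), d₁, ← u₂, act hg 2 1 0 (by norm_num), u₁]
  · intro P hP h1 hPh
    -- Two consecutive values suffice: for f those at 2, 3 and for g those at 1, 2, in each case a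
    -- value of h followed by b.
    have all : ∀ {F : ℤ → (linkL p q e).InvQuandle} (s : ℤ), IsDihedralMap F → P (F s) →
        P (F (s + 1)) → ∀ i, P (F i) := by
      intro F s hF h0 h1 i
      have := Int.reflection_induction (P := fun i => P (F (s + i))) (by simpa using h0) h1
        (fun a b ha hb => by
          have := hP _ _ ha hb
          rw [hF] at this
          convert this using 2; ring) (i - s)
      simpa using this
    refine PresentedInvQuandle.induction ?_ hP
    rw [g1] at h1
    rintro (a | a | a | a)
    · exact (congrArg P (cf a)).mpr (all 2 hf (f2 ▸ hPh _) h1 _)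
    · exact (congrArg P (cg a)).mpr (all 1 hg (u₂ ▸ hPh _) (d₁ ▸ h1) _)
    · exact (congrArg P (ch a)).mpr (hPh _)
    · exact (congrArg P ((ck a).trans (hkh _))).mpr (hPh _)
  · intro M _ h' b' hM H
    have act' : ∀ {F : ℤ → M}, IsDihedralMap F → ∀ i j m, 2 * j - i = m →
      F j ◃ F i = F m := fun hF i j m e => e ▸ hF i j
    obtain ⟨F, hF, F2, F3⟩ := IsDihedralMap.exists_zero_one hM (h' (-w)) b'
    obtain ⟨G, hG, G1, G2⟩ := IsDihedralMap.exists_zero_one hM (h' 0) b'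
    -- The shifts put h' (-w), b' at the indices 2, 3 of f' and h' 0, b' at the indices 1, 2 of g',
    -- matching the corner labels.
    let f' : ℤ → M := fun i => F (-2 + 1 * i)
    let g' : ℤ → M := fun i => G (-1 + 1 * i)
    let k' : ℤ → M := fun i => h' (p + q * i)
    have hf' : IsDihedralMap f' := hF.comp_affine _ _
    have hg' : IsDihedralMap g' := hG.comp_affine _ _
    have hk' : IsDihedralMap k' := H.dihedral.comp_affine _ _
    replace F2 : f' 2 = h' (-w) := F2
    replace F3 : f' 3 = b' := F3
    replace G1 : g' 1 = h' 0 := G1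
    replace G2 : g' 2 = b' := G2
    have f1 : f' 1 = g' 0 := by
      rw [← act' hf' 3 2 1 (by norm_num), ← act' hg' 2 1 0 (by norm_num), F2, F3, G1, G2, H.comm]
    have f4 : f' 4 = h' (q - w) := by
      rw [← act' hf' 2 3 4 (by norm_num), F2, F3, H.act_neg]
    have f0 : f' 0 = k' (-e) := by
      rw [← act' hf' 4 2 0 (by norm_num), f4, F2]
      exact act' H.dihedral _ _ _ (by rw [hw]; ring)
    have f2' : f' 2 = k' (-e + 1) := by
      rw [F2]; exact congrArg h' (by rw [hw]; ring)
    have g3 : g' 3 = h' q := by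
      rw [← act' hg' 1 2 3 (by norm_num), G1, G2, H.act_zero]
    let col : (Tangle.montesinos 1 2 1 2 p q e).Pt → M :=
      Sum.elim (f' ∘ l₁) (Sum.elim (g' ∘ l₁) (Sum.elim (h' ∘ l₃) (k' ∘ l₄)))
    have hc : (Tangle.montesinos 1 2 1 2 p q e).IsColouring col := by
      refine Tangle.isColouring_hadd.2 ⟨t₁.colouring hM hf', Tangle.isColouring_hadd.2
        ⟨t₁.colouring hM hg', Tangle.isColouring_hadd.2
        ⟨t₃.colouring hM H.dihedral, t₄.colouring hM hk', ?_, ?_⟩, ?_, ?_⟩, ?_, ?_⟩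
      · change h' (l₃ _) = k' (l₄ _)
        rw [t₃.ne, t₄.nw]; exact congrArg h' (by ring)
      · change h' (l₃ _) = k' (l₄ _)
        rw [t₃.se, t₄.sw]; exact congrArg h' (by ring)
      · change g' (l₁ _) = h' (l₃ _)
        rw [t₁.ne, t₃.nw]; exact G1
      · change g' (l₁ _) = h' (l₃ _)
        rw [t₁.se, t₃.sw]; exact g3
      · change f' (l₁ _) = g' (l₁ _)
        rw [t₁.ne, t₁.nw]; exact f1
      · change f' (l₁ _) = g' (l₁ _)
        rw [t₁.se, t₁.sw]; exact F3.trans G2.symm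
    obtain ⟨φ, hφ, hφc⟩ := Tangle.exists_lift_closure hM hc
      (by change f' (l₁ _) = k' (l₄ _); rw [t₁.nw, t₄.ne]; exact f0)
      (by change f' (l₁ _) = k' (l₄ _); rw [t₁.sw, t₄.se]; exact f2')
    have corner : ∀ a, φ (h (l₃ a)) = h' (l₃ a) := fun a => by
      rw [← ch]; exact hφc (.inr (.inr (.inl a)))
    refine ⟨φ, hφ, ?_, ?_⟩
    · refine (hφc _).trans ?_
      change f' (l₁ _) = b'
      rw [t₁.se]; exact F3
    -- The agreement of φ ∘ h with h' is known only on labels of marked points; the corner labels 0,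
    -- p, q, p + q suffice by coprimality.
    · refine (hh.map hφ).ext_of_isCoprime H.dihedral (Nat.isCoprime_iff_coprime.2 hcop)
        ?_ ?_ ?_ ?_
      · simpa only [Function.comp_apply, t₃.nw] using corner (Tangle.corner _ .nw)
      · simpa only [Function.comp_apply, t₃.ne] using corner (Tangle.corner _ .ne)
      · simpa only [Function.comp_apply, t₃.sw] using corner (Tangle.corner _ .sw)
      · simpa only [Function.comp_apply, t₃.se] using corner (Tangle.corner _ .se)

/-! ### Consequences of the relations: the upper bound -/

namespace IsDihedralMap

variable {Q : Type*} [Quandle Q] {F : ℤ → Q}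

/-- The composite of two point reflections is a translation. -/
theorem exists_translation (hF : IsDihedralMap F) (hQ : Rack.IsInvolutory Q) :
    ∃ r : Equiv.Perm Q, ∀ i j, Rack.act' (F j) * Rack.act' (F i) = r ^ (j - i) := by
  have sq : ∀ x : Q, Rack.act' x * Rack.act' x = 1 := fun x => by
    ext y; exact hQ x y
  -- The element F (i + 2) = F (i + 1) ◃ F i acts by the conjugated reflection, so composites of
  -- consecutive reflections agree.
  have step : ∀ i, Rack.act' (F (i + 1 + 1)) * Rack.act' (F (i + 1)) =
      Rack.act' (F (i + 1)) * Rack.act' (F i) := fun i => by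
    have := Rack.ad_conj (F (i + 1)) (F i)
    rw [hF, show 2 * (i + 1) - i = i + 1 + 1 by ring] at this
    rw [this, mul_assoc, inv_mul_cancel, mul_one]
  have const : ∀ i, Rack.act' (F (i + 1)) * Rack.act' (F i) =
      Rack.act' (F 1) * Rack.act' (F 0) := fun i => by
    induction i using Int.induction_on with
    | zero => rfl
    | succ i ih => rw [step, ih]
    | pred i ih => rw [← ih, ← step]; simp
  set r := Rack.act' (F 1) * Rack.act' (F 0) with hr
  have succ : ∀ i, Rack.act' (F (i + 1)) = r * Rack.act' (F i) := fun i => by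
    rw [← const i, mul_assoc, sq, mul_one]
  have formula : ∀ i : ℤ, Rack.act' (F i) = r ^ i * Rack.act' (F 0) := fun i => by
    induction i using Int.induction_on with
    | zero => simp
    | succ i ih => rw [succ, ih, ← mul_assoc, ← zpow_one_add, add_comm]
    | pred i ih =>
      have := succ (-(i : ℤ) - 1)
      rw [sub_add_cancel, ih] at this
      rw [← inv_mul_eq_iff_eq_mul, ← mul_assoc] at this
      rw [← this]
      congr 1
      rw [← zpow_neg_one, ← zpow_add]; congr 1; ring
  refine ⟨r, fun i j => ?_⟩
  have := sq (F i)
  nth_rewrite 1 [formula i] at this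
  rw [mul_assoc, mul_eq_one_iff_inv_eq] at this
  rw [formula j, mul_assoc, ← this, sub_eq_add_neg, zpow_add, zpow_neg]

theorem act_act (hF : IsDihedralMap F) (hQ : Rack.IsInvolutory Q) {i j i' j' : ℤ}
    (h : j - i = j' - i') (x : Q) : F j ◃ F i ◃ x = F j' ◃ F i' ◃ x := by
  obtain ⟨r, hr⟩ := hF.exists_translation hQ
  exact congrArg (fun s : Equiv.Perm Q => s x) ((hr i j).trans (h ▸ (hr i' j').symm))

theorem act_act_act (hF : IsDihedralMap F) (hQ : Rack.IsInvolutory Q) {i j k l : ℤ}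
    (h : k - j + i = l) (x : Q) : F k ◃ F j ◃ F i ◃ x = F l ◃ x := by
  rw [hF.act_act hQ (j' := l) (i' := i) (by omega)]
  exact congrArg _ (hQ _ _)

end IsDihedralMap

namespace IsPrismPair

variable {Q : Type*} [Quandle Q] {q w : ℤ} {h : ℤ → Q} {b : Q}

/-- In the coordinates (x, y) of the lattice, b acts as (x, y) ↦ (x, 1 - y). This is compatible with
point reflections, and on the unit square it is the two relations together with involutivity. -/
theorem act_lattice (H : IsPrismPair q w h b) (hQ : Rack.IsInvolutory Q) (x y : ℤ) :
    b ◃ h (y * q - x * w) = h (q - y * q - x * w) := by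
  refine Int.reflection_induction₂
    (P := fun x y => b ◃ h (y * q - x * w) = h (q - y * q - x * w)) ?_ ?_ ?_ ?_ ?_ x y
  · simpa using H.act_zero
  · simpa using H.act_neg
  · have : b ◃ b ◃ h 0 = h 0 := hQ _ _
    rw [H.act_zero] at this
    simpa using this
  · have : b ◃ b ◃ h (-w) = h (-w) := hQ _ _
    rw [H.act_neg] at this
    simpa using this
  · intro x y x' y' h1 h2
    rw [show (2 * y' - y) * q - (2 * x' - x) * w = 2 * (y' * q - x' * w) - (y * q - x * w) by ring,
      ← H.dihedral, Shelf.self_distrib, h1, h2, H.dihedral]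
    congr 1; ring

/-- The pairs (x, y) and (x - q, y - w) represent the same integer, but `act_lattice` gives them
images whose indices differ by 2qw. -/
theorem periodic (H : IsPrismPair q w h b) (hQ : Rack.IsInvolutory Q) (hqw : IsCoprime q w) :
    Function.Periodic h (2 * q * w) := by
  intro i
  obtain ⟨u, v, huv⟩ := hqw
  have h1 := H.act_lattice hQ (-i * v) (1 - i * u)
  have h2 := H.act_lattice hQ (-i * v - q) (1 - i * u - w)
  rw [show (1 - i * u - w) * q - (-i * v - q) * w = (1 - i * u) * q - -i * v * w by ring, h1] at h2
  convert h2.symm using 2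
  · linear_combination (-i) * huv
  · linear_combination (-i) * huv

theorem exists_act (H : IsPrismPair q w h b) (hQ : Rack.IsInvolutory Q) (hqw : IsCoprime q w)
    (i : ℤ) : ∃ j, b ◃ h i = h j := by
  obtain ⟨u, v, huv⟩ := hqw
  have h1 := H.act_lattice hQ (-i * v) (i * u)
  rw [show i * u * q - -i * v * w = i by linear_combination i * huv] at h1
  exact ⟨_, h1⟩

/-- Inserting h 0 twice and replacing one factor through `comm` composes three reflections, whose
indices combine to (i + w) - 0 + (-w) = i. -/
theorem periodic_act (H : IsPrismPair q w h b) (hQ : Rack.IsInvolutory Q) :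
    Function.Periodic (fun i => h i ◃ b) w := by
  intro i
  have h1 : h (i + w) ◃ h 0 ◃ h 0 ◃ b = h (i + w) ◃ b := congrArg _ (hQ _ _)
  change h (i + w) ◃ b = h i ◃ b
  rw [← h1, H.comm]
  exact H.dihedral.act_act_act hQ (by ring) _

/-- A composite of two reflections depends only on the index difference, and (i + w) - 0 = i - (-w);
then `comm` applies. -/
theorem periodic_act_act (H : IsPrismPair q w h b) (hQ : Rack.IsInvolutory Q) :
    Function.Periodic (fun i => h i ◃ h 0 ◃ b) w := by
  intro i
  change h (i + w) ◃ h 0 ◃ b = h i ◃ h 0 ◃ b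
  rw [H.comm, ← H.comm, H.dihedral.act_act hQ (j' := i) (i' := -w) (by ring), H.comm]

theorem cover (H : IsPrismPair q w h b) (hQ : Rack.IsInvolutory Q) (hqw : IsCoprime q w)
    (hgen : ∀ P : Q → Prop, (∀ x y, P x → P y → P (y ◃ x)) → P b → (∀ i, P (h i)) → ∀ x, P x)
    (x : Q) : (∃ i, x = h i) ∨ (∃ i, x = h i ◃ b) ∨ ∃ i, x = h i ◃ h 0 ◃ b := by
  set S : Q → Prop := fun x => (∃ i, x = h i) ∨ (∃ i, x = h i ◃ b) ∨ ∃ i, x = h i ◃ h 0 ◃ b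
  -- The elements whose action preserves S form a subquandle, since z ◃ y acts as z, y, z in
  -- succession; only b and the h j need checking.
  have stable : ∀ y x, S x → S (y ◃ x) := by
    refine hgen _ ?_ ?_ ?_
    · intro y z hy hz x hx
      have := hz _ (hy _ (hz _ hx))
      rw [Shelf.self_distrib (x := z), hQ] at this
      exact this
    · rintro _ (⟨i, rfl⟩ | ⟨i, rfl⟩ | ⟨i, rfl⟩) <;>
        obtain ⟨j, hj⟩ := H.exists_act hQ hqw i
      · exact .inl ⟨j, hj⟩
      · exact .inr (.inl ⟨j, by rw [Shelf.self_distrib, hj, Quandle.fix]⟩)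
      · refine .inr (.inr ⟨j - q, ?_⟩)
        rw [Shelf.self_distrib, hj, Shelf.self_distrib (x := b) (y := h 0), H.act_zero, Quandle.fix]
        exact H.dihedral.act_act hQ (by ring) _
    · rintro j _ (⟨i, rfl⟩ | ⟨i, rfl⟩ | ⟨i, rfl⟩)
      · exact .inl ⟨_, H.dihedral _ _⟩
      · exact .inr (.inr ⟨j - i, H.dihedral.act_act hQ (by ring) _⟩)
      · exact .inr (.inl ⟨j - i, H.dihedral.act_act_act hQ (by ring) _⟩)
  exact hgen S (fun x y hx _ => stable y x hx)
    (.inr (.inr ⟨0, (hQ _ _).symm⟩)) (fun i => .inl ⟨i, rfl⟩) x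

end IsPrismPair

/-! ### The model quandle -/

/-- The underlying set of the model of `Q₂(L(1/2, 1/2, p/q; e))`. -/
def PrismModel (q w : ℤ) : Type := ZMod (2 * q * w).natAbs ⊕ ZMod (2 * w).natAbs

namespace PrismModel

variable {q w v k : ℤ}

/-- The class of a pair of integer representatives. -/
def mk (q w : ℤ) : ℤ ⊕ ℤ → PrismModel q w := Sum.map Int.cast Int.cast

theorem mk_surjective (q w : ℤ) : Function.Surjective (mk q w) :=
  Sum.map_surjective.2 ⟨ZMod.intCast_surjective, ZMod.intCast_surjective⟩

theorem mk_inl {i j : ℤ} : mk q w (.inl i) = mk q w (.inl j) ↔ 2 * q * w ∣ j - i := by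
  rw [← Int.natAbs_dvd, ← ZMod.intCast_eq_intCast_iff_dvd_sub]
  exact Sum.inl_injective.eq_iff

theorem mk_inr {i j : ℤ} : mk q w (.inr i) = mk q w (.inr j) ↔ 2 * w ∣ j - i := by
  rw [← Int.natAbs_dvd, ← ZMod.intCast_eq_intCast_iff_dvd_sub]
  exact Sum.inr_injective.eq_iff

theorem mk_inl_ne_mk_inr {i j : ℤ} : mk q w (.inl i) ≠ mk q w (.inr j) := Sum.inl_ne_inr

/-- The operation of the model on representatives. -/
def preAct (q v : ℤ) : ℤ ⊕ ℤ → ℤ ⊕ ℤ → ℤ ⊕ ℤ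
  | .inl j, .inl i => .inl (2 * j - i)
  -- For j = 0 this is `act_lattice` at y = i v, x = -i k, where q v + w k = 1.
  | .inr j, .inl i => .inl (i - 2 * q * v * i + q - 2 * q * j)
  | .inl j, .inr i => .inr (1 - 2 * v * j - i)
  | .inr j, .inr i => .inr (2 * j - i)

theorem mk_preAct {x x' y y' : ℤ ⊕ ℤ} (hx : mk q w x = mk q w x') (hy : mk q w y = mk q w y') :
    mk q w (preAct q v y x) = mk q w (preAct q v y' x') := by
  rcases x with i | i <;> rcases x' with i' | i' <;> rcases y with j | j <;> rcases y' with j' | j'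
  all_goals first
    | exact (mk_inl_ne_mk_inr hx).elim
    | exact (mk_inl_ne_mk_inr hx.symm).elim
    | exact (mk_inl_ne_mk_inr hy).elim
    | exact (mk_inl_ne_mk_inr hy.symm).elim
    | skip
  all_goals
    simp only [mk_inl, mk_inr] at hx hy
    obtain ⟨c, hc⟩ := hx
    obtain ⟨d, hd⟩ := hy
  · exact mk_inl.2 ⟨2 * d - c, by linear_combination 2 * hd - hc⟩
  · exact mk_inl.2 ⟨c - 2 * q * v * c - 2 * d, by
      linear_combination (1 - 2 * q * v) * hc - 2 * q * hd⟩
  · exact mk_inr.2 ⟨- 2 * v * q * d - c, by linear_combination - 2 * v * hd - hc⟩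
  · exact mk_inr.2 ⟨2 * d - c, by linear_combination 2 * hd - hc⟩

/-- The operation of the model. -/
noncomputable def act (v : ℤ) (y x : PrismModel q w) : PrismModel q w :=
  mk q w (preAct q v (Function.surjInv (mk_surjective q w) y)
    (Function.surjInv (mk_surjective q w) x))

theorem act_mk (v : ℤ) (y x : ℤ ⊕ ℤ) : act v (mk q w y) (mk q w x) = mk q w (preAct q v y x) :=
  mk_preAct (Function.surjInv_eq _ _) (Function.surjInv_eq _ _)

/-- Only the second summand acting on the first needs `hk`: acting twice changes the index by a
multiple of 2q (1 - q v) = 2q w k. -/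
theorem act_act_self (hk : q * v = 1 - w * k) (y x : PrismModel q w) :
    act v y (act v y x) = x := by
  obtain ⟨y, rfl⟩ := mk_surjective q w y
  obtain ⟨x, rfl⟩ := mk_surjective q w x
  rw [act_mk, act_mk]
  rcases y with j | j <;> rcases x with i | i
  · exact mk_inl.2 ⟨0, by ring⟩
  · exact mk_inr.2 ⟨0, by ring⟩
  · exact mk_inl.2 ⟨2 * v * k * i - k * (1 - 2 * j), by
      linear_combination (-4 * q * v * i + 2 * q * (1 - 2 * j)) * hk⟩
  · exact mk_inr.2 ⟨0, by ring⟩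

theorem act_distrib (hk : q * v = 1 - w * k) (z y x : PrismModel q w) :
    act v z (act v y x) = act v (act v z y) (act v z x) := by
  obtain ⟨z, rfl⟩ := mk_surjective q w z
  obtain ⟨y, rfl⟩ := mk_surjective q w y
  obtain ⟨x, rfl⟩ := mk_surjective q w x
  simp only [act_mk]
  rcases z with l | l <;> rcases y with j | j <;> rcases x with i | i
  · exact mk_inl.2 ⟨0, by ring⟩
  · exact mk_inr.2 ⟨0, by ring⟩
  · exact mk_inl.2 ⟨0, by ring⟩
  · exact mk_inr.2 ⟨0, by ring⟩
  · exact mk_inl.2 ⟨0, by ring⟩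
  · exact mk_inr.2 ⟨k * (1 - 2 * l - 2 * v * j), by
      linear_combination (-(2 - 4 * l - 4 * v * j)) * hk⟩
  · exact mk_inl.2 ⟨2 * k * (j - l), by linear_combination (-4 * q * (j - l)) * hk⟩
  · exact mk_inr.2 ⟨0, by ring⟩

/-- The quandle structure of the model, where `v` is an inverse of `q` modulo `w`. -/
noncomputable abbrev quandle (hk : q * v = 1 - w * k) : Quandle (PrismModel q w) where
  act := act v
  self_distrib := act_distrib hk _ _ _
  invAct := act v
  left_inv := act_act_self hk
  right_inv := act_act_self hk
  fix {x} := by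
    obtain ⟨x, rfl⟩ := mk_surjective q w x
    refine (act_mk v x x).trans ?_
    rcases x with i | i
    · exact mk_inl.2 ⟨0, by ring⟩
    · exact mk_inr.2 ⟨0, by ring⟩

theorem isPrismPair (hk : q * v = 1 - w * k) :
    letI := quandle hk
    IsPrismPair q w (fun i => mk q w (.inl i)) (mk q w (.inr 0)) := by
  let := quandle hk
  refine ⟨fun i j => act_mk v _ _, (act_mk v _ _).trans ?_, (act_mk v _ _).trans ?_,
    (act_mk v _ _).trans (.trans ?_ (act_mk v _ _).symm)⟩
  · exact mk_inl.2 ⟨0, by ring⟩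
  · exact mk_inl.2 ⟨-v, by ring⟩
  · exact mk_inr.2 ⟨v, by ring⟩

end PrismModel

/-! ### Identification of the link quandle with the model -/

/-- Quandles isomorphic to the model, in terms of the families of elements that correspond to the
two summands. -/
structure IsPrismQuandle {Q : Type*} [Quandle Q] (q w v : ℤ) (h B : ℤ → Q) : Prop where
  h_eq : ∀ i j, h i = h j ↔ 2 * q * w ∣ j - i
  B_eq : ∀ i j, B i = B j ↔ 2 * w ∣ j - i
  h_ne_B : ∀ i j, h i ≠ B j
  cover : ∀ x, (∃ i, h i = x) ∨ ∃ i, B i = x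
  h_act_h : ∀ j i, h j ◃ h i = h (2 * j - i)
  B_act_h : ∀ j i, B j ◃ h i = h (i - 2 * q * v * i + q - 2 * q * j)
  h_act_B : ∀ j i, h j ◃ B i = B (1 - 2 * v * j - i)
  B_act_B : ∀ j i, B j ◃ B i = B (2 * j - i)

/-- The three families of `cover` go to the first summand and to the odd and even classes of the
second. Since v is invertible modulo w, the periods proved from the relations are precisely the
coincidences in the model, so φ is injective. -/
theorem linkL.exists_isPrismQuandle (p q : ℕ) (e w v k : ℤ) (hcop : Nat.Coprime p q)
    (hw : w = (e - 1) * (q : ℤ) - (p : ℤ)) (hk : q * v = 1 - w * k) :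
    ∃ h B : ℤ → (linkL p q e).InvQuandle, IsPrismQuandle q w v h B ∧
      gen p q e 0 = h (-w) ∧ gen p q e 1 = B 0 ∧ gen p q e 2 = h 0 := by
  obtain ⟨h, H, g0, g2, hgen, hlift⟩ := linkL.exists_isPrismPair p q e w hcop hw
  have hQ : Rack.IsInvolutory (linkL p q e).InvQuandle := PresentedInvQuandle.isInvolutory _
  let := PrismModel.quandle hk
  have hqw : IsCoprime (q : ℤ) w := ⟨v, k, by linear_combination hk⟩
  have hwv : IsCoprime w v := ⟨k, q, by linear_combination hk⟩
  obtain ⟨φ, hφ, φb, φh⟩ := hlift _ _ _ (PrismModel.act_act_self hk) (PrismModel.isPrismPair hk)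
  have φc : ∀ i, φ (h i ◃ gen p q e 1) = PrismModel.mk q w (.inr (1 - 2 * v * i)) := fun i => by
    rw [hφ, φb, φh]
    exact (PrismModel.act_mk v _ _).trans (PrismModel.mk_inr.2 ⟨0, by ring⟩)
  have φd : ∀ i, φ (h i ◃ h 0 ◃ gen p q e 1) = PrismModel.mk q w (.inr (-2 * v * i)) := fun i => by
    rw [hφ, φc, φh]
    exact (PrismModel.act_mk v _ _).trans (PrismModel.mk_inr.2 ⟨0, by ring⟩)
  have cov := H.cover hQ hqw hgen
  have heq : ∀ i j, 2 * q * w ∣ j - i → h i = h j := fun i j ⟨c, hc⟩ => by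
    have := (H.periodic hQ hqw).int_mul c i
    rw [← this]; congr 1; push_cast; linear_combination (-1) * hc
  have wdvd : ∀ i, 2 * w ∣ 2 * v * i → w ∣ i := fun i hi =>
    hwv.dvd_of_dvd_mul_left (Int.dvd_of_mul_dvd_mul_left two_ne_zero (by rwa [← mul_assoc]))
  have ceq : ∀ i j, 2 * w ∣ 2 * v * (j - i) → h i ◃ gen p q e 1 = h j ◃ gen p q e 1 :=
    fun i j hij => by
      obtain ⟨c, hc⟩ := wdvd _ hij
      have := (H.periodic_act hQ).int_mul c i
      exact this.symm.trans (congrArg (fun n => h n ◃ gen p q e 1)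
        (by push_cast; linear_combination (-1) * hc))
  have deq : ∀ i j, 2 * w ∣ 2 * v * (j - i) →
      h i ◃ h 0 ◃ gen p q e 1 = h j ◃ h 0 ◃ gen p q e 1 :=
    fun i j hij => by
      obtain ⟨c, hc⟩ := wdvd _ hij
      have := (H.periodic_act_act hQ).int_mul c i
      exact this.symm.trans (congrArg (fun n => h n ◃ h 0 ◃ gen p q e 1)
        (by push_cast; linear_combination (-1) * hc))
  have inj : Function.Injective φ := by
    intro x y hxy
    rcases cov x with ⟨i, rfl⟩ | ⟨i, rfl⟩ | ⟨i, rfl⟩ <;>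
      rcases cov y with ⟨j, rfl⟩ | ⟨j, rfl⟩ | ⟨j, rfl⟩ <;>
      simp only [φh, φc, φd] at hxy
    · exact heq _ _ (PrismModel.mk_inl.1 hxy)
    · exact (PrismModel.mk_inl_ne_mk_inr hxy).elim
    · exact (PrismModel.mk_inl_ne_mk_inr hxy).elim
    · exact (PrismModel.mk_inl_ne_mk_inr hxy.symm).elim
    · refine ceq _ _ ?_
      obtain ⟨c, hc⟩ := PrismModel.mk_inr.1 hxy
      exact ⟨-c, by linear_combination -hc⟩
    -- The representatives 1 - 2vi and -2vj differ in parity, while the modulus 2w is even.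
    · obtain ⟨c, hc⟩ := PrismModel.mk_inr.1 hxy
      simp only [mul_assoc] at hc; omega
    · exact (PrismModel.mk_inl_ne_mk_inr hxy.symm).elim
    · obtain ⟨c, hc⟩ := PrismModel.mk_inr.1 hxy
      simp only [mul_assoc] at hc; omega
    · refine deq _ _ ?_
      obtain ⟨c, hc⟩ := PrismModel.mk_inr.1 hxy
      exact ⟨-c, by linear_combination -hc⟩
  -- The index -q t yields 2t or 2t + 1, because 2 v q t ≡ 2t modulo 2w.
  have hB : ∀ m : ℤ, ∃ x, φ x = PrismModel.mk q w (.inr m) := fun m => by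
    rcases Int.even_or_odd' m with ⟨t, rfl | rfl⟩
    · exact ⟨_, (φd (-q * t)).trans
        (PrismModel.mk_inr.2 ⟨k * t, by linear_combination (-2 * t) * hk⟩)⟩
    · exact ⟨_, (φc (-q * t)).trans
        (PrismModel.mk_inr.2 ⟨k * t, by linear_combination (-2 * t) * hk⟩)⟩
  choose B φB using hB
  have act_eq : ∀ {x y z : (linkL p q e).InvQuandle} {a b c : ℤ ⊕ ℤ},
      φ x = PrismModel.mk q w a → φ y = PrismModel.mk q w b → φ z = PrismModel.mk q w c →
      PrismModel.preAct q v b a = c → y ◃ x = z := fun {x y z a b c} hx hy hz hab => inj (by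
    rw [hφ, hx, hy, hz, ← hab]
    exact PrismModel.act_mk v _ _)
  refine ⟨h, B, ⟨fun i j => ?_, fun i j => ?_, fun i j hij => ?_, fun x => ?_,
    fun j i => act_eq (φh i) (φh j) (φh _) rfl, fun j i => act_eq (φh i) (φB j) (φh _) rfl,
    fun j i => act_eq (φB i) (φh j) (φB _) rfl, fun j i => act_eq (φB i) (φB j) (φB _) rfl⟩,
    g0, inj (φb.trans (φB 0).symm), g2⟩
  · rw [← inj.eq_iff, φh, φh, PrismModel.mk_inl]
  · rw [← inj.eq_iff, φB, φB, PrismModel.mk_inr]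
  · have := congrArg φ hij
    rw [φh, φB] at this
    exact PrismModel.mk_inl_ne_mk_inr this
  · obtain ⟨i | i, hi⟩ := PrismModel.mk_surjective q w (φ x)
    · exact .inl ⟨i, inj ((φh i).trans hi)⟩
    · exact .inr ⟨i, inj ((φB i).trans hi)⟩

/-! ### Components of the Cayley graph and their sizes -/

theorem Set.ncard_range_of_eq_iff_dvd {X : Type*} {g : ℤ → X} {n : ℤ}
    (hg : ∀ i j, g i = g j ↔ n ∣ j - i) : (Set.range g).ncard = n.natAbs := by
  have hg' : ∀ i j, g i = g j ↔ (i : ZMod n.natAbs) = j := fun i j => by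
    rw [hg, ← Int.natAbs_dvd, ← ZMod.intCast_eq_intCast_iff_dvd_sub]
  rw [← Nat.card_coe_set_eq, ← Nat.card_zmod n.natAbs]
  refine (Nat.card_eq_of_bijective
    (fun z : ZMod n.natAbs => (⟨g z.cast, z.cast, rfl⟩ : Set.range g)) ⟨?_, ?_⟩).symm
  · intro z z' h
    simpa using (hg' _ _).1 (congrArg Subtype.val h)
  · rintro ⟨_, i, rfl⟩
    exact ⟨(i : ZMod n.natAbs), Subtype.ext ((hg' _ _).2 (by simp))⟩

section quandleCayleyGraph

variable {Q ι : Type} [Quandle Q] {g : ι → Q}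

theorem quandleCayleyGraph_reachable_act_gen (i : ι) (x : Q) :
    (quandleCayleyGraph g).Reachable x (g i ◃ x) := by
  by_cases h : x = g i ◃ x
  · rw [← h]
  · exact SimpleGraph.Adj.reachable ((SimpleGraph.fromRel_adj _ _ _).2 ⟨h, .inl ⟨i, rfl⟩⟩)

theorem quandleCayleyGraph_reachable_act_act (hQ : Rack.IsInvolutory Q) {y z : Q}
    (hy : ∀ x, (quandleCayleyGraph g).Reachable x (y ◃ x))
    (hz : ∀ x, (quandleCayleyGraph g).Reachable x (z ◃ x)) (x : Q) :
    (quandleCayleyGraph g).Reachable x ((z ◃ y) ◃ x) := by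
  have := ((hz x).trans (hy _)).trans (hz _)
  rwa [Shelf.self_distrib (x := z), hQ] at this

theorem quandleCayleyGraph_supp_eq (hQ : Rack.IsInvolutory Q) {S : Set Q} {a : Q} (ha : a ∈ S)
    (hS : ∀ i, ∀ x ∈ S, g i ◃ x ∈ S)
    (hreach : ∀ x ∈ S, (quandleCayleyGraph g).Reachable x a) :
    ((quandleCayleyGraph g).connectedComponentMk a).supp = S := by
  ext x
  rw [SimpleGraph.ConnectedComponent.mem_supp_iff, SimpleGraph.ConnectedComponent.eq]
  refine ⟨?_, hreach x⟩
  rintro ⟨p⟩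
  induction p with
  | nil => exact ha
  | @cons u v _ huv p ih =>
    obtain ⟨-, ⟨i, hi⟩ | ⟨i, hi⟩⟩ := (SimpleGraph.fromRel_adj _ _ _).1 huv
    · have := hS i _ (ih ha hreach)
      rw [← hi] at this
      exact (hQ (g i) u) ▸ this
    · exact hi ▸ hS i _ (ih ha hreach)

end quandleCayleyGraph

namespace IsPrismQuandle

variable {Q : Type} [Quandle Q] {q w v : ℤ} {h B : ℤ → Q} {g : Fin 3 → Q}

/-- Elements acting within components are closed under the operation. From the generators one
obtains B 1, h q and h (q - w), enough to start reflection induction in both families. -/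
theorem reachable_act (H : IsPrismQuandle q w v h B) (hQ : Rack.IsInvolutory Q) {k : ℤ}
    (hk : q * v = 1 - w * k) (g0 : g 0 = h (-w)) (g1 : g 1 = B 0) (g2 : g 2 = h 0) (y x : Q) :
    (quandleCayleyGraph g).Reachable x (y ◃ x) := by
  have b0 : ∀ x, (quandleCayleyGraph g).Reachable x (B 0 ◃ x) :=
    g1 ▸ quandleCayleyGraph_reachable_act_gen 1
  have h0 : ∀ x, (quandleCayleyGraph g).Reachable x (h 0 ◃ x) :=
    g2 ▸ quandleCayleyGraph_reachable_act_gen 2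
  have hw : ∀ x, (quandleCayleyGraph g).Reachable x (h (-w) ◃ x) :=
    g0 ▸ quandleCayleyGraph_reachable_act_gen 0
  have b1 := quandleCayleyGraph_reachable_act_act hQ b0 h0
  have hq := quandleCayleyGraph_reachable_act_act hQ h0 b0
  have hwq := quandleCayleyGraph_reachable_act_act hQ hw b0
  rw [H.h_act_B] at b1
  rw [H.B_act_h] at hq hwq
  have hwq' : h (-w - 2 * q * v * -w + q - 2 * q * 0) = h (-w + q) :=
    (H.h_eq _ _).2 ⟨-v, by ring⟩
  rw [hwq'] at hwq
  rcases H.cover y with ⟨i, rfl⟩ | ⟨i, rfl⟩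
  · exact Int.reflection_induction_of_isCoprime
      (P := fun i => ∀ x, (quandleCayleyGraph g).Reachable x (h i ◃ x)) (x := -w) (y := q)
      ⟨-k, v, by linear_combination hk⟩ h0 hw (by simpa using hq) hwq
      (fun i j hi hj => H.h_act_h j i ▸ quandleCayleyGraph_reachable_act_act hQ hi hj) i x
  · exact Int.reflection_induction
      (P := fun i => ∀ x, (quandleCayleyGraph g).Reachable x (B i ◃ x)) b0 (by simpa using b1)
      (fun i j hi hj => H.B_act_B j i ▸ quandleCayleyGraph_reachable_act_act hQ hi hj) i x

theorem supp_B (H : IsPrismQuandle q w v h B) (hQ : Rack.IsInvolutory Q) {k : ℤ}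
    (hk : q * v = 1 - w * k) (g0 : g 0 = h (-w)) (g1 : g 1 = B 0) (g2 : g 2 = h 0) :
    ((quandleCayleyGraph g).connectedComponentMk (g 1)).supp = Set.range B := by
  have reach := H.reachable_act hQ hk g0 g1 g2
  refine quandleCayleyGraph_supp_eq hQ ⟨0, g1.symm⟩ ?_ ?_
  · rintro i _ ⟨j, rfl⟩
    rcases H.cover (g i) with ⟨l, hl⟩ | ⟨l, hl⟩ <;> rw [← hl]
    · exact ⟨_, (H.h_act_B _ _).symm⟩
    · exact ⟨_, (H.B_act_B _ _).symm⟩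
  · rintro _ ⟨i, rfl⟩
    rw [g1]
    have key : ∀ i, (quandleCayleyGraph g).Reachable (B 0) (B i) := fun i => by
      rcases Int.even_or_odd' i with ⟨j, rfl | rfl⟩
      · simpa only [H.B_act_B, sub_zero] using reach (B j) (B 0)
      -- Each B j preserves the parity of indices in this family; h 0 supplies the change by sending
      -- B 0 to B 1.
      · have h1 := reach (h 0) (B 0)
        have h2 := reach (B (j + 1)) (B 1)
        rw [H.h_act_B] at h1
        rw [H.B_act_B] at h2
        ring_nf at h1 h2 ⊢
        exact h1.trans h2
    exact (key i).symm

theorem reachable_h (H : IsPrismQuandle q w v h B) (hQ : Rack.IsInvolutory Q) {k : ℤ}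
    (hk : q * v = 1 - w * k) (g0 : g 0 = h (-w)) (g1 : g 1 = B 0) (g2 : g 2 = h 0) (i j : ℤ) :
    (quandleCayleyGraph g).Reachable (h i) (h (2 * j + i)) := by
  have := H.reachable_act hQ hk g0 g1 g2 (h (j + i)) (h i)
  rw [H.h_act_h] at this
  convert this using 2; ring

theorem supp_h_of_odd (H : IsPrismQuandle q w v h B) (hQ : Rack.IsInvolutory Q) {k : ℤ}
    (hk : q * v = 1 - w * k) (g0 : g 0 = h (-w)) (g1 : g 1 = B 0) (g2 : g 2 = h 0) (hq : Odd q)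
    (s : ℤ) : ((quandleCayleyGraph g).connectedComponentMk (h s)).supp = Set.range h := by
  refine quandleCayleyGraph_supp_eq hQ ⟨s, rfl⟩ ?_ ?_
  · rintro i _ ⟨j, rfl⟩
    rcases H.cover (g i) with ⟨l, hl⟩ | ⟨l, hl⟩ <;> rw [← hl]
    · exact ⟨_, (H.h_act_h _ _).symm⟩
    · exact ⟨_, (H.B_act_h _ _).symm⟩
  · have key : ∀ i, (quandleCayleyGraph g).Reachable (h 0) (h i) := fun i => by
      rcases Int.even_or_odd' i with ⟨j, rfl | rfl⟩
      · simpa using H.reachable_h hQ hk g0 g1 g2 0 j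
      -- B 0 sends h 0 to h q, which switches parity because q is odd.
      · obtain ⟨m, hm⟩ := hq
        have h1 := H.reachable_act hQ hk g0 g1 g2 (B 0) (h 0)
        rw [H.B_act_h] at h1
        have h2 := H.reachable_h hQ hk g0 g1 g2 q (j - m)
        simp only [mul_zero, sub_zero, zero_add] at h1
        convert h1.trans h2 using 2
        omega
    rintro _ ⟨i, rfl⟩
    exact (key i).symm.trans (key s)

theorem supp_h_of_even (H : IsPrismQuandle q w v h B) (hQ : Rack.IsInvolutory Q) {k : ℤ}
    (hk : q * v = 1 - w * k) (g0 : g 0 = h (-w)) (g1 : g 1 = B 0) (g2 : g 2 = h 0) (hq : Even q)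
    (s : ℤ) : ((quandleCayleyGraph g).connectedComponentMk (h s)).supp =
      Set.range (fun i => h (2 * i + s)) := by
  refine quandleCayleyGraph_supp_eq hQ ⟨0, by simp⟩ ?_ ?_
  · obtain ⟨m, rfl⟩ := hq
    rintro i _ ⟨j, rfl⟩
    rcases H.cover (g i) with ⟨l, hl⟩ | ⟨l, hl⟩ <;> rw [← hl]
    · exact ⟨l - j - s, by simp only [H.h_act_h]; congr 1; ring⟩
    · refine ⟨j - (m + m) * v * (2 * j + s) + m - (m + m) * l, ?_⟩
      simp only [H.B_act_h]; congr 1; ring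
  · rintro _ ⟨i, rfl⟩
    exact (H.reachable_h hQ hk g0 g1 g2 s i).symm

end IsPrismQuandle

theorem mainTheorem3 (p q : ℕ) (e w : ℤ) (hp : 0 < p) (hpq : p < q) (hcop : Nat.Coprime p q)
    (hw : w = (e - 1) * (q : ℤ) - (p : ℤ)) :
    (Odd q →
      (linkL.C₁ p q e = linkL.C₃ p q e ∧ linkL.C₁ p q e ≠ linkL.C₂ p q e ∧
        ∀ C : (linkL.cayleyGraph p q e).ConnectedComponent,
          C = linkL.C₁ p q e ∨ C = linkL.C₂ p q e) ∧
      (linkL.C₁ p q e).supp.ncard = 2 * q * w.natAbs ∧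
      (linkL.C₂ p q e).supp.ncard = 2 * w.natAbs) ∧
    (Even q →
      (linkL.C₁ p q e ≠ linkL.C₂ p q e ∧ linkL.C₁ p q e ≠ linkL.C₃ p q e ∧
        linkL.C₂ p q e ≠ linkL.C₃ p q e ∧
        ∀ C : (linkL.cayleyGraph p q e).ConnectedComponent,
          C = linkL.C₁ p q e ∨ C = linkL.C₂ p q e ∨ C = linkL.C₃ p q e) ∧
      (linkL.C₁ p q e).supp.ncard = q * w.natAbs ∧
      (linkL.C₃ p q e).supp.ncard = q * w.natAbs ∧
      (linkL.C₂ p q e).supp.ncard = 2 * w.natAbs) ∧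
    Finite (linkL p q e).InvQuandle ∧
    Nat.card (linkL p q e).InvQuandle = 2 * (q + 1) * w.natAbs := by
  have hQ : Rack.IsInvolutory (linkL p q e).InvQuandle := PresentedInvQuandle.isInvolutory _
  -- From 0 < p < q it follows that q does not divide p; a nonzero w makes both families finite.
  have hw0 : w ≠ 0 := by
    rintro rfl
    have : (q : ℤ) ∣ p := ⟨e - 1, by linear_combination hw⟩
    exact absurd (Nat.le_of_dvd hp (Int.natCast_dvd_natCast.1 this)) (by omega)
  -- Modulo q the number w is -p, so a Bézout identity for p and q gives one for q and w.
  obtain ⟨v, k, hvk⟩ : IsCoprime (q : ℤ) w := by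
    obtain ⟨a, b, hab⟩ := Nat.isCoprime_iff_coprime.2 hcop
    exact ⟨b + a * (e - 1), -a, by rw [hw]; linear_combination hab⟩
  have hk : q * v = 1 - w * k := by linear_combination hvk
  obtain ⟨h, B, H, g0, g1, g2⟩ := linkL.exists_isPrismQuandle p q e w v k hcop hw hk
  have cardh : (Set.range h).ncard = 2 * q * w.natAbs := by
    rw [Set.ncard_range_of_eq_iff_dvd H.h_eq]
    simp [Int.natAbs_mul]
  have cardB : (Set.range B).ncard = 2 * w.natAbs := by
    rw [Set.ncard_range_of_eq_iff_dvd H.B_eq]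
    simp [Int.natAbs_mul]
  have suppB : (linkL.C₂ p q e).supp = Set.range B := H.supp_B hQ hk g0 g1 g2
  have compB : ∀ i, (linkL.cayleyGraph p q e).connectedComponentMk (B i) = linkL.C₂ p q e :=
    fun i => (SimpleGraph.ConnectedComponent.mem_supp_iff _ _).1 (suppB ▸ ⟨i, rfl⟩)
  have ne_B : ∀ i, (linkL.cayleyGraph p q e).connectedComponentMk (h i) ≠ linkL.C₂ p q e := by
    intro i hi
    rw [← SimpleGraph.ConnectedComponent.mem_supp_iff, suppB] at hi
    obtain ⟨j, hj⟩ := hi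
    exact H.h_ne_B _ _ hj.symm
  have c1 : linkL.C₁ p q e = (linkL.cayleyGraph p q e).connectedComponentMk (h (-w)) :=
    congrArg _ g0
  have c3 : linkL.C₃ p q e = (linkL.cayleyGraph p q e).connectedComponentMk (h 0) :=
    congrArg _ g2
  have card : Nat.card (linkL p q e).InvQuandle = 2 * (q + 1) * w.natAbs := by
    have hw1 : 0 < w.natAbs := Int.natAbs_pos.2 hw0
    have hq1 : 0 < q := by omega
    rw [← Set.ncard_univ, show Set.univ = Set.range h ∪ Set.range B from
      (Set.eq_univ_of_forall H.cover).symm, Set.ncard_union_eq ?_ ?_ ?_, cardh, cardB]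
    · ring
    · rw [Set.disjoint_left]
      rintro _ ⟨i, rfl⟩ ⟨j, hj⟩
      exact H.h_ne_B _ _ hj.symm
    · exact Set.finite_of_ncard_ne_zero (by rw [cardh]; positivity)
    · exact Set.finite_of_ncard_ne_zero (by rw [cardB]; positivity)
  have fin : Finite (linkL p q e).InvQuandle := by
    refine Nat.finite_of_card_ne_zero ?_
    rw [card]
    have := Int.natAbs_pos.2 hw0
    positivity
  refine ⟨fun hq => ?_, fun hq => ?_, fin, card⟩
  · have supp : ∀ s, ((linkL.cayleyGraph p q e).connectedComponentMk (h s)).supp = Set.range h :=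
      H.supp_h_of_odd hQ hk g0 g1 g2 (by exact_mod_cast hq)
    rw [c1, c3, supp, suppB]
    refine ⟨⟨SimpleGraph.ConnectedComponent.supp_injective ((supp _).trans (supp _).symm),
      ne_B _, fun C => ?_⟩, cardh, cardB⟩
    induction C using SimpleGraph.ConnectedComponent.ind with
    | h x =>
      rcases H.cover x with ⟨i, rfl⟩ | ⟨i, rfl⟩
      · exact .inl (SimpleGraph.ConnectedComponent.supp_injective
          ((supp _).trans (supp _).symm))
      · exact .inr (compB i)
  · have supp : ∀ s, ((linkL.cayleyGraph p q e).connectedComponentMk (h s)).supp =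
        Set.range (fun i => h (2 * i + s)) :=
      H.supp_h_of_even hQ hk g0 g1 g2 (by exact_mod_cast hq)
    have cards : ∀ s, (Set.range (fun i => h (2 * i + s))).ncard = q * w.natAbs := fun s => by
      rw [Set.ncard_range_of_eq_iff_dvd (n := q * w)]
      · simp [Int.natAbs_mul]
      · intro i j
        rw [H.h_eq, show 2 * j + s - (2 * i + s) = 2 * (j - i) by ring, mul_assoc,
          mul_dvd_mul_iff_left two_ne_zero]
    -- Since w is coprime to the even q, it is odd: h (-w) lies in the odd class and h 0 in the even
    -- one.
    obtain ⟨m, hm⟩ : Odd w := by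
      rw [← Int.not_even_iff_odd]
      intro hwe
      obtain ⟨m, hm⟩ := hq
      obtain ⟨n, hn⟩ := hwe
      have : (2 : ℤ) ∣ 1 := ⟨v * m + k * n, by rw [← hvk, hm, hn]; push_cast; ring⟩
      omega
    rw [c1, c3, supp, supp, suppB]
    refine ⟨⟨ne_B _, fun hc => ?_, (ne_B _).symm, fun C => ?_⟩, cards _, cards _, cardB⟩
    · have h1 : h (-w) ∈ ((linkL.cayleyGraph p q e).connectedComponentMk (h 0)).supp :=
        (SimpleGraph.ConnectedComponent.mem_supp_iff _ _).2 hc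
      rw [supp] at h1
      obtain ⟨i, hi⟩ := h1
      obtain ⟨c, hc⟩ := (H.h_eq _ _).1 hi
      simp only [mul_assoc] at hc
      omega
    · induction C using SimpleGraph.ConnectedComponent.ind with
      | h x =>
        rcases H.cover x with ⟨i, rfl⟩ | ⟨i, rfl⟩
        · rcases Int.even_or_odd' i with ⟨j, rfl | rfl⟩
          · refine .inr (.inr ?_)
            rw [← SimpleGraph.ConnectedComponent.mem_supp_iff, supp]
            exact ⟨j, by simp⟩
          · refine .inl ?_
            rw [← SimpleGraph.ConnectedComponent.mem_supp_iff, supp]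
            exact ⟨j + m + 1, by simp only []; congr 1; omega⟩
        · exact .inr (.inl (compB i))
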